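/- Conventions. For a finite loopless matroid $M$ with ground set $E$, rank function $\mathrm{rk}$ and lattice of flats $\mathcal L(M)$, let $\mu(M)$ be the value $\mu(\varnothing,E)$ of the Möbius function of $\mathcal L(M)$. The Kazhdan–Lusztig polynomial $P_M(x)\in\mathbb Z[x]$ and the inverse Kazhdan–Lusztig polynomial $Q_M(x)\in\mathbb Z[x]$ are the unique polynomials assigned to all finite loopless matroids such that $P_M=Q_M=1$ if $\mathrm{rk}(M)=0$, $\deg P_M,\ \deg Q_M<\tfrac12\mathrm{rk}(M)$ if $\mathrm{rk}(M)>0$, and both polynomials $$Z_M(x)=\sum_{F\in\mathcal L(M)}x^{\mathrm{rk}(F)}P_{M/F}(x),\qquad Y_M(x)=\sum_{F\in\mathcal L(M)}(-1)^{\mathrm{rk}(M)-\mathrm{rk}(F)}\mu(M/F)\,x^{\mathrm{rk}(M)-\mathrm{rk}(F)}Q_{M|_F}(x)$$ are palindromic with respect to $\mathrm{rk}(M)$, that is, $x^{\mathrm{rk}(M)}Z_M(x^{-1})=Z_M(x)$ and $x^{\mathrm{rk}(M)}Y_M(x^{-1})=Y_M(x)$; $Y_M$ is called the inverse $Z$-polynomial.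 If $M$ has a loop, set $P_M=Q_M=Y_M=0$. Let $\tau(M)$ be the coefficient of $x^{(\mathrm{rk}(M)-1)/2}$ in $P_M(x)$ if $\mathrm{rk}(M)$ is odd, and $\tau(M)=0$ if $\mathrm{rk}(M)$ is even. Let $U_{k,n}$ be the uniform matroid of rank $k$ on $n$ elements, and for $a,b\ge 2$ let $C_{a,b}$ be the graphic matroid of the graph obtained by gluing a cycle of length $a$ and a cycle of length $b$ along a common edge. **Proposition.** Let $a,b\ge 2$ and let $n=a+b-1$ be the number of elements of $C_{a,b}$. Then $$\begin{aligned}Q_{C_{a,b}}(x)&=Q_{U_{n-2,n-1}}(x)+(1+x)\,Q_{U_{a-2,a-1}}(x)\,Q_{U_{b-2,b-1}}(x)\\&\quad-\Bigl(\tau(U_{a-2,a-1})\,x^{\frac{a-1}2}\,Q_{U_{b-2,b-1}}(x)+\tau(U_{b-2,b-1})\,x^{\frac{b-1}2}\,Q_{U_{a-2,a-1}}(x)\Bigr),\\ Y_{C_{a,b}}(x)&=Y_{U_{n-2,n-1}}(x)+(1+x)\,Y_{U_{a-2,a-1}}(x)\,Y_{U_{b-2,b-1}}(x)\\&\quad-\Bigl(\tau(U_{a-2,a-1})\,x^{\frac{a-1}2}\,Y_{U_{b-2,b-1}}(x)+\tau(U_{b-2,b-1})\,x^{\frac{b-1}2}\,Y_{U_{a-2,a-1}}(x)\Bigr).\end{aligned}$$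 Here a term whose exponent $\frac{a-1}2$ or $\frac{b-1}2$ is not an integer is $0$, because its coefficient $\tau$ vanishes. -/

import Mathlib

open Polynomial Set
open scoped Matroid

/-! ### Graphic matroids and uniform matroids -/

/-- The simple graph in which two distinct vertices are adjacent if they are joined by an edge of
the multigraph `G` that belongs to `I`. -/
def Graph.simpleGraphOn {V β : Type*} (G : Graph V β) (I : Set β) : SimpleGraph V where
  Adj x y := x ≠ y ∧ ∃ e ∈ I, G.IsLink e x y
  symm := { symm := fun _ _ ⟨hne, e, he, hl⟩ ↦ ⟨hne.symm, e, he, hl.symm⟩ }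
  loopless := { irrefl := fun _ h ↦ h.1 rfl }

/-- A set `I` of edges of a multigraph `G` is a forest if the spanning subgraph of `G` with edge set
`I` has no cycle: no cycle of length one (loop), none of length two (pair of parallel edges), and
the resulting simple graph is acyclic. -/
structure Graph.IsForest {V β : Type*} (G : Graph V β) (I : Set β) : Prop where
  subset_edgeSet : I ⊆ G.edgeSet
  simple : (G.restrict I).Simple
  acyclic : (G.simpleGraphOn I).IsAcyclic

lemma Graph.IsForest.subset {V β : Type*} {G : Graph V β} {I J : Set β} (hJ : G.IsForest J)
    (hIJ : I ⊆ J) : G.IsForest I where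
  subset_edgeSet := hIJ.trans hJ.subset_edgeSet
  simple :=
    haveI := hJ.simple
    Graph.Simple.anti (G.restrict_mono_right hIJ)
  acyclic := by
    refine SimpleGraph.IsAcyclic.anti ?_ hJ.acyclic
    rintro x y ⟨hne, e, he⟩
    exact ⟨hne, e, hIJ he.1, he.2⟩

lemma Graph.isForest_empty {V β : Type*} (G : Graph V β) : G.IsForest ∅ where
  subset_edgeSet := empty_subset _
  simple :=
    { not_isLoopAt := fun _ _ h ↦ h.1
      eq_of_isLink := fun _ _ _ _ h ↦ h.1.elim }
  acyclic := by
    refine SimpleGraph.IsAcyclic.anti (G' := ⊥) ?_ SimpleGraph.isAcyclic_bot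
    rintro x y ⟨-, e, he⟩
    exact he.1.elim

/-- Adding an edge `e` to a forest `I` gives a forest exactly if `I` does not connect the
two ends of `e`. -/
lemma Graph.isForest_insert_iff {V β : Type*} {G : Graph V β} {I : Set β} (hI : G.IsForest I)
    {e : β} (heI : e ∉ I) {x y : V} (he : G.IsLink e x y) :
    G.IsForest (insert e I) ↔
      ¬ (G.simpleGraphOn I).Reachable x y := by
  have hsup : x ≠ y → G.simpleGraphOn (insert e I)
      = G.simpleGraphOn I ⊔ SimpleGraph.edge x y := by
    intro hxy
    ext u v
    rw [SimpleGraph.sup_adj, SimpleGraph.edge_adj]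
    constructor
    · rintro ⟨hne, f, hf, hl⟩
      rcases hf with rfl | hf
      · right
        refine ⟨?_, hne⟩
        rcases he.eq_and_eq_or_eq_and_eq hl with ⟨h1, h2⟩ | ⟨h1, h2⟩
        · exact Or.inl ⟨h1.symm, h2.symm⟩
        · exact Or.inr ⟨h2.symm, h1.symm⟩
      · exact Or.inl ⟨hne, f, hf, hl⟩
    · rintro (⟨hne, f, hf, hl⟩ | ⟨⟨rfl, rfl⟩ | ⟨rfl, rfl⟩, hne⟩)
      · exact ⟨hne, f, Or.inr hf, hl⟩
      · exact ⟨hne, e, Or.inl rfl, he⟩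
      · exact ⟨hne, e, Or.inl rfl, he.symm⟩
  constructor
  · intro h hr
    have hxy : x ≠ y := by
      rintro rfl
      exact h.simple.not_isLoopAt e x ⟨Or.inl rfl, he⟩
    have hac := h.acyclic
    rw [hsup hxy] at hac
    rcases (SimpleGraph.isAcyclic_sup_fromEdgeSet_iff.1 hac).2 hr with h1 | ⟨-, f, hf, hl⟩
    · exact hxy h1
    · have := h.simple.eq_of_isLink (e := e) (f := f) ⟨Or.inl rfl, he⟩ ⟨Or.inr hf, hl⟩
      exact heI (this ▸ hf)
  · intro hr
    have hxy : x ≠ y := by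
      rintro rfl
      exact hr (SimpleGraph.Reachable.refl _)
    have hpar : ∀ f ∈ I, ∀ u v, G.IsLink e u v → G.IsLink f u v → False := by
      intro f hf u v h1 h2
      rcases he.eq_and_eq_or_eq_and_eq h1 with ⟨rfl, rfl⟩ | ⟨rfl, rfl⟩
      · exact hr (SimpleGraph.Adj.reachable
          ⟨fun h ↦ hxy h, f, hf, h2⟩)
      · exact hr (SimpleGraph.Adj.reachable
          ⟨fun h ↦ hxy h, f, hf, h2.symm⟩)
    refine ⟨insert_subset he.edge_mem hI.subset_edgeSet, ?_, ?_⟩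
    · refine { not_isLoopAt := ?_, eq_of_isLink := ?_ }
      · rintro f u ⟨rfl | hf, hl⟩
        · rcases he.eq_and_eq_or_eq_and_eq hl with ⟨h1, h2⟩ | ⟨h1, h2⟩
          · exact hxy (h1.trans h2.symm)
          · exact hxy (h1.trans h2.symm)
        · exact hI.simple.not_isLoopAt f u ⟨hf, hl⟩
      · rintro f g u v ⟨rfl | hf, hfl⟩ ⟨rfl | hg, hgl⟩
        · rfl
        · exact (hpar g hg u v hfl hgl).elim
        · exact (hpar f hf u v hgl hfl).elim
        · exact hI.simple.eq_of_isLink ⟨hf, hfl⟩ ⟨hg, hgl⟩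
    · rw [hsup hxy]
      exact hI.acyclic.sup_edge_of_not_reachable hr

/-- The graphic matroid of a multigraph `G` with finitely many edges: the ground set is the set of
edges and the independent sets are the forests. -/
def graphicMatroid {V β : Type*} [Finite β] (G : Graph V β) : Matroid β :=
  IndepMatroid.matroid <| IndepMatroid.ofBdd (E := G.edgeSet) (Indep := G.IsForest)
    (indep_empty := G.isForest_empty)
    (indep_subset := fun _ _ hJ hIJ ↦ hJ.subset hIJ)
    (indep_aug := by
      intro I B hI hImax hB
      by_contra! hcon
      obtain ⟨e, heI, hins⟩ := exists_insert_of_not_maximal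
        (fun _ _ (hJ : G.IsForest _) hIJ ↦ hJ.subset hIJ) hI hImax
      have hadj : ∀ f ∈ B, ∀ u v (h : G.IsLink f u v), (G.simpleGraphOn I).Reachable
          u v := by
        intro f hf u v h
        by_cases hfI : f ∈ I
        · exact SimpleGraph.Adj.reachable ⟨fun huv ↦ hI.simple.not_isLoopAt f u
            ⟨hfI, by rwa [← huv] at h⟩,
            f, hfI, h⟩
        · by_contra hr
          exact hcon f ⟨hf, hfI⟩ ((Graph.isForest_insert_iff hI hfI h).2 hr)
      have hreach : ∀ u v : V, (G.simpleGraphOn B).Reachable u v →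
          (G.simpleGraphOn I).Reachable u v := by
        rintro u v ⟨p⟩
        induction p with
        | nil => exact SimpleGraph.Reachable.refl _
        | cons h _ ih =>
          obtain ⟨-, f, hf, hl⟩ := h
          exact (hadj f hf _ _ hl).trans ih
      obtain ⟨u, v, huv⟩ := Graph.exists_isLink_of_mem_edgeSet
        (hins.subset_edgeSet (mem_insert e I))
      refine (Graph.isForest_insert_iff hI heI huv).1 hins ?_
      by_cases heB : e ∈ B
      · exact hadj e heB u v huv
      · apply hreach
        by_contra hr
        exact hB.not_prop_of_ssuperset (ssubset_insert heB)
          ((Graph.isForest_insert_iff hB.prop heB huv).2 hr))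
    (subset_ground := fun _ hI ↦ hI.subset_edgeSet)
    (indep_bdd := ⟨(univ : Set β).ncard, fun I _ ↦ by
      rw [(toFinite (univ : Set β)).cast_ncard_eq]
      exact encard_le_encard (subset_univ I)⟩)

/-- The graph obtained by gluing a cycle of length `a` and a cycle of length `b` along a common
edge (for `2 ≤ a` and `2 ≤ b`). Its `a + b - 2` vertices are the integers modulo `a + b - 2`. The
edge `some j` joins `j` and `j + 1`, and the common edge `none` joins `0` and `a - 1`; so `none`
closes the path through `0, 1, …, a - 1` (with `a - 1` edges) to a cycle of length `a`, and the
path through `a - 1, a, …, a + b - 2 = 0` (with `b - 1` edges) to a cycle of length `b`. -/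
def gluedCyclesGraph (a b : ℕ) : Graph (ZMod (a + b - 2)) (Option (Fin (a + b - 2))) where
  vertexSet := univ
  IsLink e x y :=
    (match e with
      | none => s((0 : ZMod (a + b - 2)), ((a - 1 : ℕ) : ZMod (a + b - 2)))
      | some j => s(((j : ℕ) : ZMod (a + b - 2)), ((j : ℕ) : ZMod (a + b - 2)) + 1)) = s(x, y)
  isLink_symm _ _ := { symm := fun _ _ h ↦ h.trans Sym2.eq_swap }
  eq_or_eq_of_isLink_of_isLink _ x y v w h h' := by
    have := h.symm.trans h'
    rw [Sym2.eq_iff] at this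
    tauto
  left_mem_of_isLink _ _ _ _ := mem_univ _

/-- The graphic matroid `C_{a,b}` of two cycles of lengths `a` and `b` glued along an edge. -/
def gluedCycles (a b : ℕ) : Matroid (Option (Fin (a + b - 2))) :=
  graphicMatroid (gluedCyclesGraph a b)

/-- The uniform matroid `U_{k,n}` (for `k ≤ n`) on the ground set `Fin n`: a set is independent if
it has at most `k` elements. -/
def uniformMatroid (k n : ℕ) : Matroid (Fin n) :=
  IndepMatroid.matroid <| IndepMatroid.ofFinite (E := univ) finite_univ
    (Indep := fun I ↦ I.ncard ≤ k)
    (indep_empty := by simp)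
    (indep_subset := fun _ J hJ hIJ ↦ (ncard_le_ncard hIJ (toFinite J)).trans hJ)
    (indep_aug := by
      intro I J _ hJ hIJ
      obtain ⟨e, heJ, heI⟩ := exists_mem_notMem_of_ncard_lt_ncard hIJ (toFinite I)
      refine ⟨e, heJ, heI, ?_⟩
      rw [ncard_insert_of_notMem heI (toFinite I)]
      omega)
    (subset_ground := fun I _ ↦ subset_univ I)

/-! ### Kazhdan-Lusztig invariants of matroids

All matroids below are finite; `M ／ F` is the contraction `M/F` and `M ↾ F` the restriction `M|_F`.
As usual, the Kazhdan-Lusztig polynomial, the inverse Kazhdan-Lusztig polynomial and the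
inverse `Z`-polynomial of a matroid that has a loop are set to `0`. -/

/-- The rank of a finite matroid as a natural number. -/
noncomputable def matroidRank {α : Type*} (M : Matroid α) : ℕ := M.eRank.toNat

open Classical in
/-- The Möbius invariant `μ(M) = μ(∅, E)` of a loopless matroid: the value of the Möbius function
of the lattice of flats between the least flat (which is `∅`) and the ground set. -/
noncomputable def mobiusInvariant {α : Type*} [Finite α] (M : Matroid α) : ℤ :=
  letI : Fintype {F : Set α // M.IsFlat F} := Fintype.ofFinite _
  letI : LocallyFiniteOrder {F : Set α // M.IsFlat F} := Fintype.toLocallyFiniteOrder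
  IncidenceAlgebra.mu ℤ (⟨M.closure ∅, M.isFlat_closure ∅⟩ : {F : Set α // M.IsFlat F})
    ⟨M.E, M.ground_isFlat⟩

/-- A polynomial `p` is palindromic with respect to `r` if `x ^ r * p(1/x) = p(x)`, i.e. its degree
is at most `r` and its coefficients in degrees `i` and `r - i` agree. -/
def IsPalindromic (r : ℕ) (p : ℤ[X]) : Prop :=
  p.natDegree ≤ r ∧ ∀ i ≤ r, p.coeff i = p.coeff (r - i)

/-- The only candidate for a polynomial `p` of degree `< r / 2` such that `p + R` is palindromic
with respect to `r` (see `eq_palindromicCompletion`). -/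
noncomputable def palindromicCompletion (r : ℕ) (R : ℤ[X]) : ℤ[X] :=
  ∑ i ∈ Finset.range r with 2 * i < r, C (R.coeff (r - i) - R.coeff i) * X ^ i

lemma eq_palindromicCompletion {r : ℕ} {R p : ℤ[X]} (hp : ∀ i, r ≤ 2 * i → p.coeff i = 0)
    (h : IsPalindromic r (p + R)) : p = palindromicCompletion r R := by
  ext i
  simp only [palindromicCompletion, finsetSum_coeff, coeff_C_mul, coeff_X_pow, mul_ite, mul_one,
    mul_zero, Finset.sum_ite_eq, Finset.mem_filter, Finset.mem_range]
  split_ifs with hi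
  · have h1 := h.2 i hi.1.le
    rw [coeff_add, coeff_add, hp (r - i) (by omega)] at h1
    linarith
  · exact hp i (by omega)

open Classical in
/-- The Kazhdan-Lusztig polynomial `P_M` of a loopless matroid `M`. It is determined recursively by
`P_M = 1` if `rk M = 0`, and, if `rk M > 0`, by `deg P_M < rk M / 2` together with the condition that
`Z_M = ∑_F x ^ rk F * P_{M/F}` (sum over all flats `F`) is palindromic; in that sum the term for
`F = ∅` is `P_M`, and the sum below is over the other flats. -/
noncomputable def klPoly {α : Type*} [Finite α] (M : Matroid α) : ℤ[X] :=
  if M.Loopless then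
    if matroidRank M = 0 then 1
    else palindromicCompletion (matroidRank M)
      (∑ᶠ F : {F : Set α // M.IsFlat F ∧ F.Nonempty},
        X ^ (M.eRk F.1).toNat * klPoly (M ／ F.1))
  else 0
termination_by M.E.ncard
decreasing_by
  refine ncard_lt_ncard ?_ (toFinite _)
  obtain ⟨x, hx⟩ := F.2.2
  exact ⟨sdiff_subset, fun h ↦ (h (F.2.1.subset_ground hx)).2 hx⟩

/-- `τ(M)`: the coefficient of `x ^ ((rk M - 1) / 2)` in `P_M` if `rk M` is odd, otherwise `0`. -/
noncomputable def klTau {α : Type*} [Finite α] (M : Matroid α) : ℤ :=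
  if Odd (matroidRank M) then (klPoly M).coeff ((matroidRank M - 1) / 2) else 0

open Classical in
/-- The inverse Kazhdan-Lusztig polynomial `Q_M` of a loopless matroid `M`. It is determined
recursively by `Q_M = 1` if `rk M = 0`, and, if `rk M > 0`, by `deg Q_M < rk M / 2` together with the
condition that the inverse `Z`-polynomial `Y_M` (see `inverseZPoly`) is palindromic; in the sum that
defines `Y_M` the term for `F = E` is `Q_M`, and the sum below is over the other flats. -/
noncomputable def inverseKLPoly {α : Type*} [Finite α] (M : Matroid α) : ℤ[X] :=
  if M.Loopless then
    if matroidRank M = 0 then 1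
    else palindromicCompletion (matroidRank M)
      (∑ᶠ F : {F : Set α // M.IsFlat F ∧ F ≠ M.E},
        C ((-1) ^ (matroidRank M - (M.eRk F.1).toNat) * mobiusInvariant (M ／ F.1)) *
          X ^ (matroidRank M - (M.eRk F.1).toNat) * inverseKLPoly (M ↾ F.1))
  else 0
termination_by M.E.ncard
decreasing_by
  exact ncard_lt_ncard (F.2.1.subset_ground.ssubset_of_ne F.2.2) (toFinite _)

/-- The inverse `Z`-polynomial
`Y_M = ∑_F (-1) ^ (rk M - rk F) * μ(M/F) * x ^ (rk M - rk F) * Q_{M|_F}`, where the sum is over all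
flats `F` of `M`. (If `M` has a loop then so does every `M|_F`, and `Y_M = 0`.) -/
noncomputable def inverseZPoly {α : Type*} [Finite α] (M : Matroid α) : ℤ[X] :=
  ∑ᶠ F : {F : Set α // M.IsFlat F},
    C ((-1) ^ (matroidRank M - (M.eRk F.1).toNat) * mobiusInvariant (M ／ F.1)) *
      X ^ (matroidRank M - (M.eRk F.1).toNat) * inverseKLPoly (M ↾ F.1)

/-! ### Palindromic polynomials -/

/-! The degree bound and palindromicity determine `Q_M`, so it suffices to exhibit a polynomial
satisfying both; the same computation yields `Y_M`.

The sum over flats becomes a sum over all subsets `s = E \ F` of the ground set. By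
`mobiusInvariant_contract`, `μ(M/F)` is, up to sign, the alternating count `coindepSum M s` of
coindependent subsets of `s`, and this count vanishes when `F` is not a flat. If `F` is independent,
then `Q` of the restriction to `F` is `1`.

Write `S_m` for `circuitSum m`, `T_m` for `cardSum m`, `Q_m` for `circuitQ m` and `τ_m` for
`circuitTau m`. A circuit with `m` elements, the matroid `U_{m-1,m}`, has `Y = Q_m + S_m`, and
adding coloops multiplies `Y` by a power of `1 + x`. Multiplying the `Y` of a circuit by `1 + x` and
correcting the middle coefficient gives the recursion `Q_{m+1} = (1 + x) Q_m + 1 - τ_m x^(m/2)`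
(`circuitQ_succ`).

For circuits `A ∪ {e}` and `B ∪ {e}` glued along `e`, with `p = |A|` and `r = |B|`, the subset sum
is `Q + S_p S_r + Q_{p+1} S_r + Q_{r+1} S_p + x T_p T_r`. The recursion and the identity
`circuitSum_add` turn it into the claimed formula for `Y` as soon as `Q` is the claimed one
(`thetaY_eq`). Every summand of that formula is palindromic of degree `p + r - 1`, and the claimed
`Q` has small enough degree.

Two points remain. The number `τ` is defined through `P`, but for a circuit `P_m` is the alternating
binomial sum of the `Q_k`, whose coefficient in degree `(m - 2)/2`, for even `m`, is that of `Q_m`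
(`HasUniqueCircuit.klTau_eq`). And `isTheta_gluedCycles` identifies the forests of the concrete
graph with the sets containing none of the three cycles. -/

lemma isPalindromic_iff_reflect {r : ℕ} {p : ℤ[X]} :
    IsPalindromic r p ↔ p.natDegree ≤ r ∧ reflect r p = p := by
  refine and_congr_right fun hp ↦ ⟨fun h ↦ ?_, fun h i hi ↦ ?_⟩
  · ext i
    rw [coeff_reflect]
    rcases le_or_gt i r with hi | hi
    · rw [revAt_le hi, ← h i hi]
    · rw [revAt_eq_self_of_lt hi]
  · conv_lhs => rw [← h, coeff_reflect, revAt_le hi]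

namespace IsPalindromic

lemma zero (r : ℕ) : IsPalindromic r 0 := ⟨by simp, by simp⟩

lemma add {r : ℕ} {p q : ℤ[X]} (hp : IsPalindromic r p) (hq : IsPalindromic r q) :
    IsPalindromic r (p + q) :=
  ⟨(natDegree_add_le _ _).trans (max_le hp.1 hq.1), fun i hi ↦ by
    rw [coeff_add, coeff_add, hp.2 i hi, hq.2 i hi]⟩

lemma sum {ι : Type*} {r : ℕ} {s : Finset ι} {p : ι → ℤ[X]}
    (h : ∀ i ∈ s, IsPalindromic r (p i)) : IsPalindromic r (∑ i ∈ s, p i) :=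
  Finset.sum_induction _ _ (fun _ _ ↦ IsPalindromic.add) (zero r) h

lemma mul {r s : ℕ} {p q : ℤ[X]} (hp : IsPalindromic r p) (hq : IsPalindromic s q) :
    IsPalindromic (r + s) (p * q) := by
  rw [isPalindromic_iff_reflect] at *
  exact ⟨natDegree_mul_le.trans (add_le_add hp.1 hq.1), by
    rw [reflect_mul _ _ hp.1 hq.1, hp.2, hq.2]⟩

lemma C (c : ℤ) : IsPalindromic 0 (Polynomial.C c) := ⟨by simp, by simp⟩

lemma C_mul {r : ℕ} {p : ℤ[X]} (c : ℤ) (hp : IsPalindromic r p) :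
    IsPalindromic r (Polynomial.C c * p) := by
  simpa using (C c).mul hp

lemma neg {r : ℕ} {p : ℤ[X]} (hp : IsPalindromic r p) : IsPalindromic r (-p) := by
  simpa using hp.C_mul (-1)

lemma sub {r : ℕ} {p q : ℤ[X]} (hp : IsPalindromic r p) (hq : IsPalindromic r q) :
    IsPalindromic r (p - q) := by
  simpa [sub_eq_add_neg] using hp.add hq.neg

lemma X_pow (k : ℕ) : IsPalindromic (2 * k) (X ^ k) := by
  rw [isPalindromic_iff_reflect]
  refine ⟨by rw [natDegree_X_pow]; omega, ?_⟩
  rw [reflect_monomial, revAt_le (by omega)]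
  congr 1
  omega

lemma one_add_X : IsPalindromic 1 (1 + X) := by
  rw [isPalindromic_iff_reflect]
  refine ⟨(natDegree_add_le _ _).trans (by simp), ?_⟩
  rw [reflect_add, reflect_one_X, reflect_one, pow_one, add_comm]

lemma one_add_X_pow (k : ℕ) : IsPalindromic k ((1 + X) ^ k) := by
  induction k with
  | zero => simpa using C 1
  | succ k ih => rw [pow_succ]; exact ih.mul one_add_X

end IsPalindromic

lemma coeff_palindromicCompletion (r : ℕ) (R : ℤ[X]) (i : ℕ) :
    (palindromicCompletion r R).coeff i =
      if 2 * i < r then R.coeff (r - i) - R.coeff i else 0 := by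
  simp only [palindromicCompletion, finsetSum_coeff, coeff_C_mul, coeff_X_pow, mul_ite, mul_one,
    mul_zero, Finset.sum_ite_eq, Finset.mem_filter, Finset.mem_range]
  congr 1
  exact propext ⟨fun h ↦ h.2, fun h ↦ ⟨by omega, h⟩⟩

lemma coeff_palindromicCompletion_eq_zero {r i : ℕ} (R : ℤ[X]) (hi : r ≤ 2 * i) :
    (palindromicCompletion r R).coeff i = 0 := by
  rw [coeff_palindromicCompletion, if_neg (by omega)]

/-- Below the middle the completion adds exactly the asymmetry of `R`; a middle coefficient is its
own mirror image and needs no correction. -/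
lemma isPalindromic_palindromicCompletion_add {r : ℕ} {R : ℤ[X]} (hR : R.natDegree ≤ r) :
    IsPalindromic r (palindromicCompletion r R + R) := by
  constructor
  · refine (natDegree_add_le _ _).trans (max_le ?_ hR)
    rw [natDegree_le_iff_coeff_eq_zero]
    exact fun i hi ↦ coeff_palindromicCompletion_eq_zero R (by omega)
  · intro i hi
    rw [coeff_add, coeff_add, coeff_palindromicCompletion, coeff_palindromicCompletion]
    rcases lt_trichotomy (2 * i) r with h | h | h
    · rw [if_pos h, if_neg (by omega)]
      ring
    · have : r - i = i := by omega
      simp only [this]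
    · rw [if_neg (by omega), if_pos (by omega), Nat.sub_sub_self hi]
      ring

/-! ### The polynomials of a circuit -/

/-- The sum of `(|G| - 1) x ^ (|G| - 1)` over the subsets `G` of a set with `m` elements. -/
noncomputable def circuitSum : ℕ → ℤ[X]
  | 0 => 0
  | m + 1 => (1 + X) * circuitSum m + (1 + X) ^ m - 1

/-- The sum of `|G| x ^ (|G| - 1)` over the subsets `G` of a set with `m` elements. -/
noncomputable def cardSum : ℕ → ℤ[X]
  | 0 => 0
  | m + 1 => (1 + X) * cardSum m + (1 + X) ^ m

lemma Finset.sum_powerset_pow_card {α : Type*} {R : Type*} [CommRing R] (x : R) (s : Finset α) :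
    ∑ t ∈ s.powerset, x ^ t.card = (1 + x) ^ s.card := by
  have := Finset.sum_pow_mul_eq_add_pow x 1 s
  simpa [add_comm] using this

lemma sum_powerset_circuitSum {α : Type*} (s : Finset α) :
    ∑ t ∈ s.powerset, ((t.card - 1 : ℕ) : ℤ[X]) * X ^ (t.card - 1) = circuitSum s.card := by
  classical
  induction s using Finset.induction_on with
  | empty => simp [circuitSum]
  | insert a s ha ih =>
    have h : ∑ t ∈ s.powerset, (((insert a t).card - 1 : ℕ) : ℤ[X]) * X ^ ((insert a t).card - 1)
        = X * circuitSum s.card + (1 + X) ^ s.card - 1 := by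
      have h1 : ∑ t ∈ s.powerset, (if t = ∅ then (1 : ℤ[X]) else 0) = 1 := by
        rw [Finset.sum_ite_eq' s.powerset ∅, if_pos (Finset.empty_mem_powerset s)]
      rw [← ih, ← Finset.sum_powerset_pow_card, Finset.mul_sum, ← Finset.sum_add_distrib]
      rw [← h1, ← Finset.sum_sub_distrib]
      refine Finset.sum_congr rfl fun t ht ↦ ?_
      have hat : a ∉ t := fun h ↦ ha (Finset.mem_powerset.1 ht h)
      rw [Finset.card_insert_of_notMem hat, Nat.add_sub_cancel]
      split_ifs with h0
      · simp [h0]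
      · obtain ⟨k, hk⟩ : ∃ k, t.card = k + 1 :=
          ⟨t.card - 1, by have := Finset.card_pos.2 (Finset.nonempty_iff_ne_empty.2 h0); omega⟩
        rw [hk, Nat.add_sub_cancel]
        push_cast
        ring
    rw [Finset.sum_powerset_insert ha, ih, h, Finset.card_insert_of_notMem ha, circuitSum]
    ring

lemma sum_powerset_cardSum {α : Type*} (s : Finset α) :
    ∑ t ∈ s.powerset, (t.card : ℤ[X]) * X ^ (t.card - 1) = cardSum s.card := by
  classical
  induction s using Finset.induction_on with
  | empty => simp [cardSum]
  | insert a s ha ih =>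
    have h : ∑ t ∈ s.powerset, ((insert a t).card : ℤ[X]) * X ^ ((insert a t).card - 1)
        = X * cardSum s.card + (1 + X) ^ s.card := by
      rw [← ih, ← Finset.sum_powerset_pow_card, Finset.mul_sum, ← Finset.sum_add_distrib]
      refine Finset.sum_congr rfl fun t ht ↦ ?_
      have hat : a ∉ t := fun h ↦ ha (Finset.mem_powerset.1 ht h)
      rw [Finset.card_insert_of_notMem hat, Nat.add_sub_cancel]
      rcases Nat.eq_zero_or_pos t.card with h0 | h0
      · simp [h0]
      · obtain ⟨k, hk⟩ : ∃ k, t.card = k + 1 := ⟨t.card - 1, by omega⟩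
        rw [hk, Nat.add_sub_cancel]
        push_cast
        ring
    rw [Finset.sum_powerset_insert ha, ih, h, Finset.card_insert_of_notMem ha, cardSum]
    ring

/-- Termwise this splits `(|G| - 1) x ^ |G|`; the summand `1` compensates for the empty set, where
the truncated `|G| - 1` is `0`. -/
lemma X_mul_circuitSum (m : ℕ) : X * circuitSum m = 1 + X * cardSum m - (1 + X) ^ m := by
  induction m with
  | zero => simp [circuitSum, cardSum]
  | succ m ih =>
    rw [circuitSum, cardSum, pow_succ]
    linear_combination (1 + X) * ih

/-- This is the product rule: `cardSum m` is the derivative of `(1 + x) ^ m`. -/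
lemma cardSum_add (p r : ℕ) :
    cardSum (p + r) = cardSum p * (1 + X) ^ r + (1 + X) ^ p * cardSum r := by
  induction r with
  | zero => simp [cardSum]
  | succ r ih =>
    rw [← add_assoc, cardSum, cardSum, ih]
    ring

/-- After multiplication by `x`, every `circuitSum` can be expressed through `cardSum` and powers of
`1 + x`, and the product rule for `cardSum` finishes. This is the identity that produces the large
circuit with `p + r` elements in the final formula. -/
lemma circuitSum_add (p r : ℕ) :
    circuitSum (p + r) + X * circuitSum p * circuitSum r - circuitSum p - circuitSum r =
      X * cardSum p * cardSum r := by
  have h1 := X_mul_circuitSum p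
  have h2 := X_mul_circuitSum r
  have h3 := X_mul_circuitSum (p + r)
  rw [cardSum_add] at h3
  refine mul_left_cancel₀ (X_ne_zero (R := ℤ)) ?_
  linear_combination h3 + (X * circuitSum r - 1) * h1 + (X * cardSum p - (1 + X) ^ p) * h2

lemma natDegree_circuitSum_le (m : ℕ) : (circuitSum m).natDegree ≤ m - 1 := by
  have h := sum_powerset_circuitSum (Finset.range m)
  rw [Finset.card_range] at h
  rw [← h]
  refine natDegree_sum_le_of_forall_le _ _ fun t ht ↦ ?_
  have := Finset.card_le_card (Finset.mem_powerset.1 ht)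
  rw [Finset.card_range] at this
  rw [← C_eq_natCast]
  exact (natDegree_C_mul_X_pow_le _ _).trans (by omega)

/-- The inverse Kazhdan-Lusztig polynomial of a circuit with `m` elements. -/
noncomputable def circuitQ (m : ℕ) : ℤ[X] := palindromicCompletion (m - 1) (circuitSum m)

lemma coeff_circuitQ_eq_zero {m i : ℕ} (hi : m - 1 ≤ 2 * i) : (circuitQ m).coeff i = 0 :=
  coeff_palindromicCompletion_eq_zero _ hi

lemma natDegree_circuitQ_le (m : ℕ) : (circuitQ m).natDegree ≤ (m - 2) / 2 := by
  rw [natDegree_le_iff_coeff_eq_zero]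
  exact fun i hi ↦ coeff_circuitQ_eq_zero (by omega)

lemma circuitQ_zero : circuitQ 0 = 0 := by
  ext i
  exact coeff_circuitQ_eq_zero (by omega)

lemma circuitQ_one : circuitQ 1 = 0 := by
  ext i
  exact coeff_circuitQ_eq_zero (by omega)

lemma isPalindromic_circuitY (m : ℕ) : IsPalindromic (m - 1) (circuitQ m + circuitSum m) :=
  isPalindromic_palindromicCompletion_add (natDegree_circuitSum_le m)

/-- The coefficient of `x ^ ((m - 2) / 2)` in the inverse Kazhdan-Lusztig polynomial of a circuit
with `m` elements, if the rank `m - 1` is odd. -/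
noncomputable def circuitTau (m : ℕ) : ℤ :=
  if Odd (m - 1) then (circuitQ m).coeff ((m - 1 - 1) / 2) else 0

/-- Adding `circuitSum (m + 1)` to the right-hand side gives `(1 + x) (circuitQ m + circuitSum m) +
(1 + x) ^ m - τ x ^ (m / 2)`, all palindromic of degree `m`. The term with `τ` removes the one
coefficient of `(1 + x) * circuitQ m` that violates the degree bound, which can occur only for even
`m`. -/
lemma circuitQ_succ {m : ℕ} (hm : 1 ≤ m) :
    circuitQ (m + 1) = (1 + X) * circuitQ m + 1 - C (circuitTau m) * X ^ (m / 2) := by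
  have hodd : Odd (m - 1) ↔ Even m := by
    rw [Nat.odd_sub hm]
    simp
  symm
  refine eq_palindromicCompletion ?_ ?_
  · intro i hi
    rw [Nat.add_sub_cancel] at hi
    have hi0 : i ≠ 0 := by omega
    obtain ⟨j, rfl⟩ := Nat.exists_eq_succ_of_ne_zero hi0
    simp only [Nat.succ_eq_add_one] at *
    rw [coeff_sub, coeff_add, add_mul, one_mul, coeff_add, coeff_X_mul,
      coeff_circuitQ_eq_zero (i := j + 1) (by omega), coeff_one, if_neg (by omega), coeff_C_mul,
      coeff_X_pow, circuitTau]
    by_cases hev : Even m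
    · obtain ⟨k, hk⟩ := hev
      rw [if_pos (hodd.2 ⟨k, hk⟩)]
      split_ifs with h
      · rw [show (m - 1 - 1) / 2 = j by omega]
        ring
      · rw [coeff_circuitQ_eq_zero (i := j) (by omega)]
        ring
    · rw [if_neg (fun h ↦ hev (hodd.1 h))]
      have : m ≠ 2 * (j + 1) := fun h ↦ hev ⟨j + 1, by omega⟩
      rw [coeff_circuitQ_eq_zero (i := j) (by omega)]
      ring
  · rw [Nat.add_sub_cancel]
    have h1 : IsPalindromic m ((1 + X) * (circuitQ m + circuitSum m)) := by
      have := IsPalindromic.one_add_X.mul (isPalindromic_circuitY m)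
      rwa [show 1 + (m - 1) = m by omega] at this
    have h2 : IsPalindromic m (C (circuitTau m) * X ^ (m / 2)) := by
      by_cases hev : Even m
      · obtain ⟨k, hk⟩ := hev
        have := (IsPalindromic.X_pow (m / 2)).C_mul (circuitTau m)
        rwa [show 2 * (m / 2) = m by omega] at this
      · rw [circuitTau, if_neg (fun h ↦ hev (hodd.1 h)), C_0, zero_mul]
        exact IsPalindromic.zero m
    convert (h1.add (IsPalindromic.one_add_X_pow m)).sub h2 using 1
    rw [circuitSum]
    ring

/-- The Kazhdan-Lusztig polynomial of a circuit with `m` elements. -/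
noncomputable def circuitP (m : ℕ) : ℤ[X] :=
  ∑ k ∈ Finset.range m.succ, m.choose k • ((-1) ^ k * circuitQ k)

lemma circuitP_card {α : Type*} (s : Finset α) :
    circuitP s.card = ∑ t ∈ s.powerset, (-1) ^ t.card * circuitQ t.card :=
  (Finset.sum_powerset_apply_card (fun k ↦ (-1) ^ k * circuitQ k)).symm

lemma circuitP_zero : circuitP 0 = 0 := by simp [circuitP, circuitQ_zero]

lemma circuitP_one : circuitP 1 = 0 := by
  simp [circuitP, Finset.sum_range_succ, circuitQ_zero, circuitQ_one]

lemma coeff_circuitP_eq_zero {m i : ℕ} (hi : m - 1 ≤ 2 * i) : (circuitP m).coeff i = 0 := by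
  rw [circuitP, finsetSum_coeff]
  refine Finset.sum_eq_zero fun k hk ↦ ?_
  have hkm := Finset.mem_range.1 hk
  have h1 : ((-1 : ℤ[X]) ^ k) = C ((-1) ^ k) := by simp
  rw [coeff_smul, h1, coeff_C_mul, coeff_circuitQ_eq_zero (by omega)]
  simp

/-- Only the summand `k = m` reaches this degree, and its sign is `+1` because `m` is even. -/
lemma coeff_circuitP_half {m : ℕ} (hm : Odd (m - 1)) :
    (circuitP m).coeff ((m - 1 - 1) / 2) = (circuitQ m).coeff ((m - 1 - 1) / 2) := by
  obtain ⟨k, hk⟩ := hm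
  have h1 : ∀ k, ((-1 : ℤ[X]) ^ k) = C ((-1) ^ k) := by simp
  rw [circuitP, finsetSum_coeff, Finset.sum_range_succ, Finset.sum_eq_zero, zero_add]
  · have hev : Even m := ⟨k + 1, by omega⟩
    simp [hev.neg_one_pow]
  · intro j hj
    have hjm := Finset.mem_range.1 hj
    rw [coeff_smul, h1, coeff_C_mul, coeff_circuitQ_eq_zero (by omega)]
    simp

/-! ### Sums over subsets and the `Z`-polynomial of a circuit. -/

lemma sum_powerset_union {α R : Type*} [DecidableEq α] [AddCommMonoid R] {s t : Finset α}
    (h : Disjoint s t) (f : Finset α → R) :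
    ∑ v ∈ (s ∪ t).powerset, f v = ∑ v ∈ s.powerset, ∑ w ∈ t.powerset, f (v ∪ w) := by
  induction t using Finset.induction_on generalizing f with
  | empty => simp
  | insert a t ha ih =>
    rw [Finset.disjoint_insert_right] at h
    have has : a ∉ s ∪ t := by simp [h.1, ha]
    rw [Finset.union_insert, Finset.sum_powerset_insert has, ih h.2, ih h.2,
      ← Finset.sum_add_distrib]
    refine Finset.sum_congr rfl fun v _ ↦ ?_
    rw [Finset.sum_powerset_insert ha]
    simp only [Finset.union_insert]

/-- Exchange the sums: for fixed `k`, the sets `t` between `k` and `s` contribute a binomial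
expansion. -/
lemma sum_powerset_sum_powerset {α R : Type*} [DecidableEq α] [CommRing R] (s : Finset α)
    (x : R) (f : Finset α → R) :
    ∑ t ∈ s.powerset, x ^ (s \ t).card * ∑ k ∈ t.powerset, f k =
      ∑ k ∈ s.powerset, f k * (1 + x) ^ (s \ k).card := by
  induction s using Finset.induction_on generalizing f with
  | empty => simp
  | insert a s ha ih =>
    have h1 : ∀ k ∈ s.powerset, a ∉ k := fun k hk h ↦ ha (Finset.mem_powerset.1 hk h)
    have h2 : ∀ k ∈ s.powerset, (insert a s \ k).card = (s \ k).card + 1 := fun k hk ↦ by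
      rw [Finset.insert_sdiff_of_notMem _ (h1 k hk), Finset.card_insert_of_notMem]
      simp [ha]
    have h3 : ∀ k ∈ s.powerset, insert a s \ insert a k = s \ k := fun k hk ↦ by
      rw [Finset.insert_sdiff_insert, Finset.sdiff_insert_of_notMem ha]
    rw [Finset.sum_powerset_insert ha, Finset.sum_powerset_insert ha]
    have e1 : ∑ t ∈ s.powerset, x ^ (insert a s \ t).card * ∑ k ∈ t.powerset, f k =
        x * ∑ k ∈ s.powerset, f k * (1 + x) ^ (s \ k).card := by
      rw [← ih, Finset.mul_sum]
      refine Finset.sum_congr rfl fun t ht ↦ ?_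
      rw [h2 t ht]
      ring
    have e2 : ∑ t ∈ s.powerset, x ^ (insert a s \ insert a t).card *
        ∑ k ∈ (insert a t).powerset, f k =
        ∑ k ∈ s.powerset, f k * (1 + x) ^ (s \ k).card +
          ∑ k ∈ s.powerset, f (insert a k) * (1 + x) ^ (s \ k).card := by
      rw [← ih, ← ih (fun k ↦ f (insert a k)), ← Finset.sum_add_distrib]
      refine Finset.sum_congr rfl fun t ht ↦ ?_
      rw [h3 t ht, Finset.sum_powerset_insert (h1 t ht)]
      ring
    have e3 : ∑ k ∈ s.powerset, f k * (1 + x) ^ (insert a s \ k).card =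
        (1 + x) * ∑ k ∈ s.powerset, f k * (1 + x) ^ (s \ k).card := by
      rw [Finset.mul_sum]
      refine Finset.sum_congr rfl fun t ht ↦ ?_
      rw [h2 t ht]
      ring
    have e4 : ∑ k ∈ s.powerset, f (insert a k) * (1 + x) ^ (insert a s \ insert a k).card =
        ∑ k ∈ s.powerset, f (insert a k) * (1 + x) ^ (s \ k).card :=
      Finset.sum_congr rfl fun t ht ↦ by rw [h3 t ht]
    rw [e1, e2, e3, e4]
    ring

/-- Pairing `k` with `insert a k` and using the recursion of `circuitSum` leaves `(-1) ^ |k| ((1 +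
x) ^ (n - |k|) - (1 + x) ^ n)`, where `n = |s| - 1`. The first part sums to `x ^ n`, the second to
`0` since `n > 0`. -/
lemma sum_powerset_neg_one_pow_mul_circuitSum {α : Type*} [DecidableEq α] {s : Finset α}
    (hs : 2 ≤ s.card) :
    ∑ k ∈ s.powerset, (-1) ^ k.card * circuitSum k.card * (1 + X) ^ (s \ k).card =
      X ^ (s.card - 1) := by
  have hne : s.Nonempty := Finset.card_pos.1 (by omega)
  obtain ⟨a, ha⟩ := hne
  obtain ⟨s, has, rfl⟩ : ∃ t, a ∉ t ∧ insert a t = s :=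
    ⟨s.erase a, by simp, Finset.insert_erase ha⟩
  rw [Finset.card_insert_of_notMem has] at hs ⊢
  rw [Finset.sum_powerset_insert has, ← Finset.sum_add_distrib, Nat.add_sub_cancel]
  have h1 : ∑ k ∈ s.powerset, ((-1 : ℤ[X]) ^ k.card * (1 + X) ^ (s \ k).card -
      (-1) ^ k.card * (1 + X) ^ s.card) = X ^ s.card := by
    rw [Finset.sum_sub_distrib, ← Finset.sum_mul, Finset.sum_powerset_pow_card,
      show (1 + -1 : ℤ[X]) = 0 by ring, zero_pow (by omega), zero_mul, sub_zero]
    have h := Finset.sum_pow_mul_eq_add_pow (-1 : ℤ[X]) (1 + X) s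
    rw [show (-1 + (1 + X) : ℤ[X]) = X by ring] at h
    rw [← h]
    refine Finset.sum_congr rfl fun t ht ↦ ?_
    rw [Finset.card_sdiff_of_subset (Finset.mem_powerset.1 ht)]
  rw [← h1]
  refine Finset.sum_congr rfl fun k hk ↦ ?_
  have hks := Finset.mem_powerset.1 hk
  have hak : a ∉ k := fun h ↦ has (hks h)
  have hc : (s \ k).card + k.card = s.card := by
    rw [Finset.card_sdiff_of_subset hks]
    have := Finset.card_le_card hks
    omega
  have e1 : (insert a s \ k).card = (s \ k).card + 1 := by
    rw [Finset.insert_sdiff_of_notMem _ hak, Finset.card_insert_of_notMem]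
    simp [has]
  have e2 : insert a s \ insert a k = s \ k := by
    rw [Finset.insert_sdiff_insert, Finset.sdiff_insert_of_notMem has]
  rw [e1, e2, Finset.card_insert_of_notMem hak, circuitSum, ← hc]
  ring

/-- Expanding both `circuitP` and `x ^ (|s| - 1)` as alternating sums over `k ⊆ s` combines them
into `± (circuitQ + circuitSum) (1 + x) ^ |s \ k|`, palindromic term by term. -/
lemma isPalindromic_circuitZ {α : Type*} [DecidableEq α] {s : Finset α} (hs : 2 ≤ s.card) :
    IsPalindromic (s.card - 1) (X ^ (s.card - 1) +
      ∑ t ∈ s.powerset, X ^ (s \ t).card * circuitP t.card) := by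
  simp only [circuitP_card]
  rw [sum_powerset_sum_powerset, ← sum_powerset_neg_one_pow_mul_circuitSum hs,
    ← Finset.sum_add_distrib]
  refine IsPalindromic.sum fun k hk ↦ ?_
  have hks := Finset.mem_powerset.1 hk
  rw [← add_mul, ← mul_add, add_comm (circuitSum _), mul_assoc]
  -- For empty `k` the degrees would not add up, as `0 - 1 = 0`; but that summand vanishes.
  rcases Nat.eq_zero_or_pos k.card with h0 | h0
  · rw [h0, circuitQ_zero, circuitSum]
    simpa using IsPalindromic.zero _
  have h := ((isPalindromic_circuitY k.card).mul
    (IsPalindromic.one_add_X_pow (s \ k).card)).C_mul ((-1) ^ k.card)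
  have hc : (s \ k).card + k.card = s.card := by
    rw [Finset.card_sdiff_of_subset hks]
    have := Finset.card_le_card hks
    omega
  rw [show k.card - 1 + (s \ k).card = s.card - 1 by omega] at h
  simpa using h

/-! ### Sums over all subsets of the ground set -/

section General

lemma loopless_contract_iff {α : Type*} {M : Matroid α} {F : Set α} (hF : F ⊆ M.E) :
    (M ／ F).Loopless ↔ M.IsFlat F := by
  rw [Matroid.isFlat_iff_closure_eq]
  constructor
  · intro h
    have := M.contract_loops_eq F
    rw [(M ／ F).loops_eq_empty, eq_comm, sdiff_eq_empty] at this
    exact this.antisymm (M.subset_closure F)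
  · intro h
    refine ⟨?_⟩
    rw [M.contract_loops_eq F, h, sdiff_self]

lemma inverseKLPoly_of_not_loopless {α : Type*} [Finite α] {M : Matroid α}
    (hM : ¬ M.Loopless) : inverseKLPoly M = 0 := by
  rw [inverseKLPoly, if_neg hM]

lemma inverseKLPoly_of_rank_eq_zero {α : Type*} [Finite α] {M : Matroid α}
    (hM : M.Loopless) (hr : matroidRank M = 0) :
    inverseKLPoly M = 1 := by
  rw [inverseKLPoly, if_pos hM, if_pos hr]

lemma klPoly_of_not_loopless {α : Type*} [Finite α] {M : Matroid α}
    (hM : ¬ M.Loopless) : klPoly M = 0 := by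
  rw [klPoly, if_neg hM]

lemma klPoly_of_rank_eq_zero {α : Type*} [Finite α] {M : Matroid α}
    (hM : M.Loopless) (hr : matroidRank M = 0) : klPoly M = 1 := by
  rw [klPoly, if_pos hM, if_pos hr]

open Classical in
/-- The sum of `(-1) ^ |t|` over the coindependent subsets `t` of `s`. -/
noncomputable def coindepSum {α : Type*} (M : Matroid α) (s : Finset α) : ℤ :=
  ∑ t ∈ s.powerset with M.Coindep ((t : Finset α) : Set α), (-1) ^ t.card

lemma coindepSum_contract {α : Type*} {M : Matroid α} {s : Finset α} {F : Set α} (hs : Disjoint (s : Set α) F) :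
    coindepSum (M ／ F) s = coindepSum M s := by
  classical
  unfold coindepSum
  refine Finset.sum_congr (Finset.filter_congr fun t ht ↦ ?_) fun _ _ ↦ rfl
  rw [Matroid.coindep_contract_iff, and_iff_left]
  have hts : (t : Set α) ⊆ s := Finset.coe_subset.2 (Finset.mem_powerset.1 ht)
  exact hs.mono_left hts

/-- A loop is a coloop of the dual, so inserting or removing it preserves coindependence and
reverses the sign. -/
lemma coindepSum_eq_zero {α : Type*} {M : Matroid α} {l : α} {s : Finset α} (hl : M.IsLoop l) (hls : l ∈ s) :
    coindepSum M s = 0 := by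
  classical
  obtain ⟨s, hs, rfl⟩ : ∃ t, l ∉ t ∧ insert l t = s :=
    ⟨s.erase l, by simp, Finset.insert_erase hls⟩
  unfold coindepSum
  rw [Finset.sum_filter, Finset.sum_powerset_insert hs, ← Finset.sum_add_distrib]
  refine Finset.sum_eq_zero fun t ht ↦ ?_
  have hlt : l ∉ t := fun h ↦ hs (Finset.mem_powerset.1 ht h)
  have h : M.Coindep ((insert l t : Finset α) : Set α) ↔ M.Coindep (t : Set α) := by
    rw [Finset.coe_insert]
    refine ⟨fun h ↦ Matroid.Indep.subset h (subset_insert _ _), fun h ↦ ?_⟩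
    exact hl.dual_isColoop.insert_indep_of_indep h
  rw [Finset.card_insert_of_notMem hlt]
  by_cases hc : M.Coindep (t : Set α)
  · rw [if_pos hc, if_pos (h.2 hc)]
    ring
  · rw [if_neg hc, if_neg (fun h' ↦ hc (h.1 h'))]
    rfl

/-- Contracting a non-flat creates a loop. This is what permits summing over all subsets instead of
flats. -/
lemma coindepSum_eq_zero_of_not_isFlat {α : Type*} [DecidableEq α] {M : Matroid α} {E s F : Finset α} (hE : M.E = E) (hF : F ⊆ E)
    (hs : s = E \ F) (h : ¬ M.IsFlat F) : coindepSum M s = 0 := by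
  have hFE : (F : Set α) ⊆ M.E := by rw [hE]; exact_mod_cast hF
  rw [← loopless_contract_iff hFE, Matroid.loopless_iff_forall_not_isLoop] at h
  push Not at h
  obtain ⟨l, hlE, hl⟩ := h
  rw [← coindepSum_contract (F := (F : Set α))]
  · refine coindepSum_eq_zero hl ?_
    rw [Matroid.contract_ground, hE] at hlE
    rw [hs]
    exact_mod_cast hlE
  · rw [hs, Finset.disjoint_coe]
    exact Finset.sdiff_disjoint

lemma finsum_subtype_eq_sum_filter {α : Type*} [Finite α] {R : Type*} [AddCommMonoid R] {p : Set α → Prop}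
    {s : Finset (Finset α)} [DecidablePred fun t : Finset α ↦ p t]
    (hp : ∀ t : Finset α, p t → t ∈ s) (f : Set α → R) :
    ∑ᶠ F : {F : Set α // p F}, f F.1 = ∑ t ∈ s with p ((t : Finset α) : Set α), f t := by
  classical
  have := Fintype.ofFinite α
  rw [finsum_eq_sum_of_fintype]
  refine Finset.sum_bij' (fun F _ ↦ F.1.toFinset) (fun t ht ↦ ⟨t, (Finset.mem_filter.1 ht).2⟩)
    ?_ ?_ ?_ ?_ ?_
  · rintro ⟨F, hF⟩ -
    have : p (F.toFinset : Set α) := by simpa using hF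
    exact Finset.mem_filter.2 ⟨hp _ this, this⟩
  · intro t ht
    exact Finset.mem_univ _
  · rintro ⟨F, hF⟩ -
    simp
  · intro t ht
    simp
  · rintro ⟨F, hF⟩ -
    simp

/-! ### Möbius invariants and the terms of the inverse `Z`-polynomial. -/

variable {α : Type*} [Fintype α] [DecidableEq α] {M : Matroid α} {E : Finset α}

/-- The right-hand side obeys the recursion of the Möbius function: grouping the subsets of `F` by
their closure, its sum over the flats below `F` is `∑ (-1) ^ |t|` over all `t ⊆ F`, which is `0`
unless `F = ∅`. -/
lemma mobius_flats_eq (hE : M.E = E) (hM : M.Loopless)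
    {_ : DecidableEq {F : Set α // M.IsFlat F}}
    {_ : LocallyFiniteOrder {F : Set α // M.IsFlat F}} [DecidablePred fun F : Set α ↦ M.IsFlat F]
    [∀ F : Set α, DecidablePred fun t : Finset α ↦ M.closure (t : Set α) = F]
    (F : {F : Set α // M.IsFlat F}) :
    IncidenceAlgebra.mu ℤ (⟨M.closure ∅, M.isFlat_closure ∅⟩ : {F : Set α // M.IsFlat F}) F =
      ∑ t ∈ E.powerset with M.closure ((t : Finset α) : Set α) = F.1, (-1) ^ t.card := by
  classical
  induction F using WellFoundedLT.induction with
  | ind F ih =>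
  have hbot : ∀ G : {F : Set α // M.IsFlat F},
      (⟨M.closure ∅, M.isFlat_closure ∅⟩ : {F : Set α // M.IsFlat F}) ≤ G := fun G ↦ by
    change M.closure ∅ ⊆ G.1
    conv_rhs => rw [← G.2.closure]
    exact M.closure_subset_closure (empty_subset _)
  have h1 := IncidenceAlgebra.sum_Icc_mu_right (𝕜 := ℤ)
    (⟨M.closure ∅, M.isFlat_closure ∅⟩ : {F : Set α // M.IsFlat F}) F
  have h2 : ∑ G ∈ Finset.Icc (⟨M.closure ∅, M.isFlat_closure ∅⟩ : {F : Set α // M.IsFlat F}) F,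
      ∑ t ∈ E.powerset with M.closure ((t : Finset α) : Set α) = G.1, (-1 : ℤ) ^ t.card =
      if (⟨M.closure ∅, M.isFlat_closure ∅⟩ : {F : Set α // M.IsFlat F}) = F then 1 else 0 := by
    have hFE := F.2.subset_ground
    rw [hE] at hFE
    have h3 := Finset.sum_powerset_neg_one_pow_card (x := F.1.toFinset)
    have h4 : (F.1.toFinset = ∅) ↔
        (⟨M.closure ∅, M.isFlat_closure ∅⟩ : {F : Set α // M.IsFlat F}) = F := by
      rw [toFinset_eq_empty, Subtype.ext_iff]
      simp only
      have : M.closure ∅ = ∅ := by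
        have := hM
        exact M.loops_eq_empty
      rw [this]
      exact eq_comm
    simp only [h4] at h3
    rw [← h3, eq_comm]
    rw [← Finset.sum_fiberwise_of_maps_to
      (g := fun t : Finset α ↦ (⟨M.closure (t : Set α), M.isFlat_closure _⟩ :
        {F : Set α // M.IsFlat F})) (t := Finset.Icc
          (⟨M.closure ∅, M.isFlat_closure ∅⟩ : {F : Set α // M.IsFlat F}) F)]
    · refine Finset.sum_congr rfl fun G hG ↦ ?_
      refine Finset.sum_congr ?_ fun _ _ ↦ rfl
      ext t
      simp only [Finset.mem_filter, Finset.mem_powerset, Subtype.ext_iff]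
      refine and_congr_left fun ht ↦ ?_
      have hGF : G.1 ⊆ F.1 := (Finset.mem_Icc.1 hG).2
      constructor
      · intro h x hx
        exact Finset.mem_coe.1 (hFE (by simpa using h hx))
      · intro h x hx
        have hs : (t : Set α) ⊆ M.E := by rw [hE]; exact_mod_cast h
        have := M.subset_closure (t : Set α) hs (Finset.mem_coe.2 hx)
        rw [ht] at this
        simpa using hGF this
    · intro t ht
      rw [Finset.mem_Icc]
      refine ⟨hbot _, ?_⟩
      change M.closure _ ⊆ F.1
      conv_rhs => rw [← F.2.closure]
      refine M.closure_subset_closure ?_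
      simpa using ht
  rw [← h2] at h1
  have hmem : F ∈ Finset.Icc (⟨M.closure ∅, M.isFlat_closure ∅⟩ : {F : Set α // M.IsFlat F}) F :=
    Finset.mem_Icc.2 ⟨hbot F, le_rfl⟩
  rw [← Finset.add_sum_erase _ _ hmem, ← Finset.add_sum_erase _ _ hmem] at h1
  rw [Finset.sum_congr rfl (g := fun G ↦
    ∑ t ∈ E.powerset with M.closure ((t : Finset α) : Set α) = G.1, (-1 : ℤ) ^ t.card)] at h1
  · exact add_right_cancel h1
  · intro G hG
    rw [Finset.mem_erase, Finset.mem_Icc] at hG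
    exact ih G (lt_of_le_of_ne hG.2.2 hG.1)

/-- Complementation exchanges spanning and coindependent sets. -/
lemma mobiusInvariant_eq (hE : M.E = E) (hM : M.Loopless) :
    mobiusInvariant M = (-1) ^ E.card * coindepSum M E := by
  classical
  rw [mobiusInvariant, mobius_flats_eq hE hM, coindepSum, Finset.mul_sum]
  refine Finset.sum_nbij' (fun t ↦ E \ t) (fun t ↦ E \ t) ?_ ?_ ?_ ?_ ?_
  · intro t ht
    rw [Finset.mem_filter, Finset.mem_powerset] at *
    refine ⟨Finset.sdiff_subset, ?_⟩
    rw [Matroid.coindep_iff_closure_compl_eq_ground (by rw [hE]; simp)]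
    have h : M.closure (t : Set α) = M.E := ht.2
    rw [hE] at h ⊢
    rw [← Finset.coe_sdiff, Finset.sdiff_sdiff_eq_self ht.1, h]
  · intro t ht
    rw [Finset.mem_filter, Finset.mem_powerset] at *
    refine ⟨Finset.sdiff_subset, ?_⟩
    have := ht.2.closure_compl
    rw [hE] at this
    simpa [hE] using this
  · intro t ht
    rw [Finset.mem_filter, Finset.mem_powerset] at ht
    exact Finset.sdiff_sdiff_eq_self ht.1
  · intro t ht
    rw [Finset.mem_filter, Finset.mem_powerset] at ht
    exact Finset.sdiff_sdiff_eq_self ht.1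
  · intro t ht
    rw [Finset.mem_filter, Finset.mem_powerset] at ht
    have := Finset.card_sdiff_add_card_eq_card ht.1
    rw [← this, pow_add]
    have h1 : (-1 : ℤ) ^ (E \ t).card * (-1) ^ (E \ t).card = 1 := by
      rw [← mul_pow]; simp
    linear_combination (-(-1 : ℤ) ^ t.card) * h1

lemma mobiusInvariant_contract {F : Finset α} (hE : M.E = E) (h : M.IsFlat F) :
    mobiusInvariant (M ／ (F : Set α)) = (-1) ^ (E \ F).card * coindepSum M (E \ F) := by
  rw [mobiusInvariant_eq (E := E \ F), coindepSum_contract]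
  · rw [Finset.disjoint_coe]
    exact Finset.sdiff_disjoint
  · rw [Matroid.contract_ground, hE]
    simp
  · exact (loopless_contract_iff h.subset_ground).2 h

/-- The summand of the inverse `Z`-polynomial that belongs to the complement of `s`. -/
noncomputable def inverseZTerm (M : Matroid α) (E s : Finset α) : ℤ[X] :=
  C ((-1) ^ (matroidRank M - (M.eRk (E \ s : Finset α)).toNat + s.card) * coindepSum M s) *
    X ^ (matroidRank M - (M.eRk (E \ s : Finset α)).toNat) *
    inverseKLPoly (M ↾ ((E \ s : Finset α) : Set α))

lemma sum_filter_isFlat_eq (hE : M.E = E) {p : Finset α → Prop} [DecidablePred p]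
    [DecidablePred fun t : Finset α ↦ M.IsFlat t ∧ p t] :
    ∑ t ∈ E.powerset with M.IsFlat ((t : Finset α) : Set α) ∧ p t,
      C ((-1) ^ (matroidRank M - (M.eRk t).toNat) * mobiusInvariant (M ／ (t : Set α))) *
        X ^ (matroidRank M - (M.eRk t).toNat) * inverseKLPoly (M ↾ (t : Set α)) =
      ∑ s ∈ E.powerset with p (E \ s), inverseZTerm M E s := by
  rw [Finset.sum_filter, Finset.sum_filter]
  refine Finset.sum_nbij' (fun t ↦ E \ t) (fun t ↦ E \ t) (by simp) (by simp) ?_ ?_ ?_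
  · exact fun t ht ↦ Finset.sdiff_sdiff_eq_self (Finset.mem_powerset.1 ht)
  · exact fun t ht ↦ Finset.sdiff_sdiff_eq_self (Finset.mem_powerset.1 ht)
  · intro t ht
    rw [Finset.mem_powerset] at ht
    rw [inverseZTerm, Finset.sdiff_sdiff_eq_self ht]
    by_cases hp : p t
    · by_cases hf : M.IsFlat (t : Set α)
      · rw [if_pos ⟨hf, hp⟩, if_pos hp, mobiusInvariant_contract hE hf, pow_add, mul_assoc]
        ring_nf
      · rw [if_neg (fun h ↦ hf h.1), if_pos hp, coindepSum_eq_zero_of_not_isFlat hE ht rfl hf]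
        simp
    · rw [if_neg hp, if_neg (fun h ↦ hp h.2)]

lemma inverseZTerm_empty (hE : M.E = E) : inverseZTerm M E ∅ = inverseKLPoly M := by
  have h : M.eRk (E : Set α) = M.eRank := by rw [← hE, Matroid.eRk_ground]
  rw [inverseZTerm, Finset.sdiff_empty, ← hE, Matroid.restrict_ground_eq_self, hE, h,
    matroidRank, Nat.sub_self, coindepSum]
  have hc : M.Coindep ∅ := M✶.empty_indep
  simp [Finset.filter_singleton, hc]

lemma inverseZPoly_eq (hE : M.E = E) :
    inverseZPoly M = inverseKLPoly M + ∑ s ∈ E.powerset.erase ∅, inverseZTerm M E s := by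
  classical
  rw [← inverseZTerm_empty hE, Finset.add_sum_erase _ _ (Finset.empty_mem_powerset E),
    inverseZPoly]
  have h := sum_filter_isFlat_eq hE (p := fun _ ↦ True)
  simp only [and_true, Finset.filter_true] at h
  rw [← h]
  exact finsum_subtype_eq_sum_filter (s := E.powerset) (p := fun F ↦ M.IsFlat F)
    (fun t ht ↦ by
      have := ht.subset_ground
      rw [hE] at this
      rw [Finset.mem_powerset]
      exact_mod_cast this)
    (fun F ↦ C ((-1) ^ (matroidRank M - (M.eRk F).toNat) * mobiusInvariant (M ／ F)) *
      X ^ (matroidRank M - (M.eRk F).toNat) * inverseKLPoly (M ↾ F))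

/-- The criterion by which all inverse Kazhdan-Lusztig polynomials below are found: guess `q`, then
check degree and palindromicity. -/
lemma inverseKLPoly_eq (hE : M.E = E) (hM : M.Loopless) (hr : matroidRank M ≠ 0) {q : ℤ[X]}
    (hq : ∀ i, matroidRank M ≤ 2 * i → q.coeff i = 0)
    (h : IsPalindromic (matroidRank M) (q + ∑ s ∈ E.powerset.erase ∅, inverseZTerm M E s)) :
    inverseKLPoly M = q := by
  classical
  rw [inverseKLPoly, if_pos hM, if_neg hr, eq_palindromicCompletion hq h]
  congr 1
  have h := finsum_subtype_eq_sum_filter (s := E.powerset) (p := fun F ↦ M.IsFlat F ∧ F ≠ M.E)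
    (fun t ht ↦ by
      have := ht.1.subset_ground
      rw [hE] at this
      rw [Finset.mem_powerset]
      exact_mod_cast this)
    (fun F ↦ C ((-1) ^ (matroidRank M - (M.eRk F).toNat) * mobiusInvariant (M ／ F)) *
      X ^ (matroidRank M - (M.eRk F).toNat) * inverseKLPoly (M ↾ F))
  rw [sum_filter_isFlat_eq hE (p := fun t ↦ (t : Set α) ≠ M.E)] at h
  rw [h]
  refine Finset.sum_congr ?_ fun _ _ ↦ rfl
  ext s
  rw [Finset.mem_filter, Finset.mem_erase, Finset.mem_powerset, and_comm]
  refine and_congr_left fun hs ↦ ?_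
  rw [hE, ne_eq, Finset.coe_inj, Finset.sdiff_eq_self_iff_disjoint, ne_eq, not_iff_not]
  constructor
  · intro h
    have := h.symm.eq_bot_of_le hs
    exact this
  · rintro rfl
    simp

lemma klPoly_eq (hE : M.E = E) (hM : M.Loopless) (hr : matroidRank M ≠ 0) {p : ℤ[X]}
    (hp : ∀ i, matroidRank M ≤ 2 * i → p.coeff i = 0)
    (h : IsPalindromic (matroidRank M) (p + ∑ t ∈ E.powerset.erase ∅,
      X ^ (M.eRk t).toNat * klPoly (M ／ (t : Set α)))) :
    klPoly M = p := by
  classical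
  rw [klPoly, if_pos hM, if_neg hr, eq_palindromicCompletion hp h]
  congr 1
  rw [finsum_subtype_eq_sum_filter (s := E.powerset.erase ∅)
    (p := fun F ↦ M.IsFlat F ∧ F.Nonempty)
    (fun t ht ↦ by
      have := ht.1.subset_ground
      rw [hE] at this
      rw [Finset.mem_erase, Finset.mem_powerset]
      exact ⟨(Finset.coe_nonempty.1 ht.2).ne_empty, by exact_mod_cast this⟩)
    (fun F ↦ X ^ (M.eRk F).toNat * klPoly (M ／ F)), Finset.sum_filter]
  refine Finset.sum_congr rfl fun t ht ↦ ?_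
  rw [Finset.mem_erase, Finset.mem_powerset] at ht
  split_ifs with hf
  · rfl
  · rw [klPoly_of_not_loopless, mul_zero]
    rw [loopless_contract_iff (by rw [hE]; exact_mod_cast ht.2)]
    exact fun h ↦ hf ⟨h, Finset.coe_nonempty.2 (Finset.nonempty_iff_ne_empty.2 ht.1)⟩

end General

/-! ### Free matroids and matroids with a unique circuit -/

lemma matroidRank_eq_card {α : Type*} [Finite α] {M : Matroid α} {I : Finset α}
    (hI : M.Indep I) (h : ∀ J : Finset α, M.Indep J → J.card ≤ I.card) :
    matroidRank M = I.card := by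
  classical
  have := Fintype.ofFinite α
  obtain ⟨B, hB⟩ := M.exists_isBase
  have h1 := hI.encard_le_eRank
  rw [← hB.encard_eq_eRank] at h1
  have h2 := h B.toFinset (by simpa using hB.indep)
  rw [matroidRank, ← hB.encard_eq_eRank]
  rw [encard_coe_eq_coe_finsetCard] at h1
  have h3 : B.encard = B.toFinset.card := by
    rw [← encard_coe_eq_coe_finsetCard, coe_toFinset]
  rw [h3] at h1 ⊢
  have h1' : I.card ≤ B.toFinset.card := by exact_mod_cast h1
  simpa using le_antisymm h2 h1'

lemma toNat_eRk_eq_card {α : Type*} {M : Matroid α} {I : Finset α} (hI : M.Indep I) :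
    (M.eRk I).toNat = I.card := by
  rw [hI.eRk_eq_encard, encard_coe_eq_coe_finsetCard, ENat.toNat_natCast]

lemma coindep_iff_exists_finset {α : Type*} [Finite α] [DecidableEq α] {M : Matroid α}
    {E t : Finset α} (hE : M.E = E) :
    M.Coindep t ↔ t ⊆ E ∧ ∃ J : Finset α, J ⊆ E \ t ∧ M.Indep J ∧ J.card = matroidRank M := by
  classical
  have := Fintype.ofFinite α
  rw [Matroid.coindep_iff_exists', and_comm, hE, Finset.coe_subset]
  refine and_congr_right fun _ ↦ ⟨?_, ?_⟩
  · rintro ⟨B, hB, hBt⟩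
    refine ⟨B.toFinset, ?_, by simpa using hB.indep, ?_⟩
    · rw [← Finset.coe_subset]
      simpa using hBt
    · rw [matroidRank, ← hB.encard_eq_eRank, ← coe_toFinset B, encard_coe_eq_coe_finsetCard]
      simp
  · rintro ⟨J, hJ, hJi, hJc⟩
    refine ⟨J, ?_, by exact_mod_cast hJ⟩
    refine hJi.isBase_of_eRk_ge J.finite_toSet ?_
    rw [hJi.eRk_eq_encard, encard_coe_eq_coe_finsetCard, hJc, matroidRank, ENat.natCast_toNat]
    rw [Matroid.eRank_ne_top_iff]
    infer_instance

lemma loopless_of_forall_indep_singleton {α : Type*} {M : Matroid α}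
    (h : ∀ e ∈ M.E, M.Indep {e}) : M.Loopless := by
  rw [Matroid.loopless_iff_forall_isNonloop]
  exact fun e he ↦ Matroid.indep_singleton.1 (h e he)

lemma not_loopless_of_not_indep_singleton {α : Type*} {M : Matroid α} {e : α} (he : e ∈ M.E)
    (h : ¬ M.Indep {e}) : ¬ M.Loopless := by
  rw [Matroid.loopless_iff_forall_isNonloop]
  exact fun h' ↦ h (Matroid.indep_singleton.2 (h' e he))

lemma inverseZPoly_of_not_loopless {α : Type*} [Finite α] {M : Matroid α} (hM : ¬ M.Loopless) :
    inverseZPoly M = 0 := by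
  rw [Matroid.loopless_iff_forall_not_isLoop] at hM
  push Not at hM
  obtain ⟨l, -, hl⟩ := hM
  rw [inverseZPoly, finsum_congr (g := fun _ ↦ 0), finsum_zero]
  intro F
  have hlF := hl.mem_of_isFlat F.2
  rw [inverseKLPoly_of_not_loopless, mul_zero]
  refine not_loopless_of_not_indep_singleton (e := l) hlF ?_
  rw [Matroid.restrict_indep_iff]
  exact fun h ↦ (Matroid.indep_singleton.1 h.1).not_isLoop hl

lemma sum_powerset_filter_card_le_one {β : Type*} [DecidableEq β] (s : Finset β) :
    ∑ t ∈ s.powerset with t.card ≤ 1, (-1 : ℤ) ^ t.card = 1 - s.card := by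
  induction s using Finset.induction_on with
  | empty => simp [Finset.filter_singleton]
  | insert a s ha ih =>
    rw [Finset.sum_filter] at *
    rw [Finset.sum_powerset_insert ha, ih, Finset.card_insert_of_notMem ha,
      Finset.sum_eq_single ∅]
    · simp
      ring
    · intro t ht hne
      have hat : a ∉ t := fun h ↦ ha (Finset.mem_powerset.1 ht h)
      have := Finset.card_pos.2 (Finset.nonempty_iff_ne_empty.2 hne)
      rw [Finset.card_insert_of_notMem hat, if_neg (by omega)]
    · simp

lemma Finset.exists_subset_singleton_of_card_le_one {β : Type*} {s t : Finset β}
    (hs : s.Nonempty) (hts : t ⊆ s)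
    (ht : t.card ≤ 1) : ∃ a ∈ s, t ⊆ {a} := by
  obtain rfl | ⟨x, hx⟩ := t.eq_empty_or_nonempty
  · obtain ⟨c, hc⟩ := hs
    exact ⟨c, hc, by simp⟩
  · refine ⟨x, hts hx, fun y hy ↦ ?_⟩
    rw [Finset.mem_singleton]
    exact Finset.card_le_one.1 ht y hy x hx

section Classes

variable {α : Type*} [DecidableEq α] {M : Matroid α} {E C D : Finset α}

/-- The matroid `M` has ground set `C ∪ D` and a unique circuit, which is `C`. -/
structure HasUniqueCircuit (M : Matroid α) (C D : Finset α) : Prop where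
  ground : M.E = (C ∪ D : Finset α)
  disjoint : Disjoint C D
  nonempty : C.Nonempty
  indep_iff : ∀ I : Finset α, M.Indep I ↔ I ⊆ C ∪ D ∧ ¬ C ⊆ I

namespace HasUniqueCircuit

lemma indep_erase (h : HasUniqueCircuit M C D) {c : α} (hc : c ∈ C) :
    M.Indep ((C ∪ D).erase c : Finset α) := by
  rw [h.indep_iff]
  exact ⟨Finset.erase_subset _ _, fun h' ↦ Finset.notMem_erase c _ (h' hc)⟩

lemma card_lt (h : HasUniqueCircuit M C D) {J : Finset α} (hJ : M.Indep J) :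
    J.card < (C ∪ D).card := by
  rw [h.indep_iff] at hJ
  refine Finset.card_lt_card ⟨hJ.1, fun h' ↦ hJ.2 (Finset.subset_union_left.trans h')⟩

lemma loopless (h : HasUniqueCircuit M C D) (hC : 2 ≤ C.card) : M.Loopless := by
  refine loopless_of_forall_indep_singleton fun e he ↦ ?_
  have := h.indep_iff {e}
  rw [Finset.coe_singleton] at this
  rw [this]
  rw [h.ground] at he
  refine ⟨by simpa using he, fun h' ↦ ?_⟩
  have := Finset.card_le_card h'
  rw [Finset.card_singleton] at this
  omega

lemma not_loopless (h : HasUniqueCircuit M C D) (hC : C.card = 1) : ¬ M.Loopless := by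
  obtain ⟨c, rfl⟩ := Finset.card_eq_one.1 hC
  refine not_loopless_of_not_indep_singleton (e := c) (by rw [h.ground]; simp) ?_
  have := h.indep_iff {c}
  rw [Finset.coe_singleton] at this
  rw [this]
  simp

lemma restrict (h : HasUniqueCircuit M C D) {D' : Finset α} (hD : D' ⊆ D) :
    HasUniqueCircuit (M ↾ ((C ∪ D' : Finset α) : Set α)) C D' where
  ground := rfl
  disjoint := h.disjoint.mono_right hD
  nonempty := h.nonempty
  indep_iff I := by
    rw [Matroid.restrict_indep_iff, h.indep_iff, Finset.coe_subset]
    have : I ⊆ C ∪ D' → I ⊆ C ∪ D := fun h ↦ h.trans (Finset.union_subset_union subset_rfl hD)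
    tauto

end HasUniqueCircuit

variable [Fintype α]

/-- In a free matroid only `∅` is coindependent, so the term of `s` is `x ^ |s|` and the total is
`(1 + x) ^ |E|`. -/
lemma inverseKLPoly_of_indep_ground (hE : M.E = E) (h : M.Indep E) : inverseKLPoly M = 1 := by
  induction hn : E.card using Nat.strong_induction_on generalizing E M with
  | _ n ih =>
  subst hn
  have hM : M.Loopless := loopless_of_forall_indep_singleton fun e he ↦
    h.subset (by rw [hE] at he; simpa using he)
  have hrk : matroidRank M = E.card := matroidRank_eq_card h fun J hJ ↦ by
    have := hJ.subset_ground
    rw [hE, Finset.coe_subset] at this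
    exact Finset.card_le_card this
  rcases Nat.eq_zero_or_pos E.card with h0 | h0
  · exact inverseKLPoly_of_rank_eq_zero hM (hrk.trans h0)
  refine inverseKLPoly_eq hE hM (by omega) ?_ ?_
  · intro i hi
    rw [coeff_one, if_neg (by omega)]
  have hterm : ∀ s ∈ E.powerset.erase ∅, inverseZTerm M E s = X ^ s.card := by
    intro s hs
    rw [Finset.mem_erase, Finset.mem_powerset] at hs
    have hind : M.Indep (E \ s : Finset α) := h.subset (by simp)
    have hc := Finset.card_sdiff_add_card_eq_card hs.2
    have hpos := Finset.card_pos.2 (Finset.nonempty_iff_ne_empty.2 hs.1)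
    rw [inverseZTerm, toNat_eRk_eq_card hind, hrk, show E.card - (E \ s).card = s.card by omega,
      ih (E \ s).card (by omega) (E := E \ s) (M := M ↾ ((E \ s : Finset α) : Set α)) rfl
        (by rw [Matroid.restrict_indep_iff]; exact ⟨hind, subset_rfl⟩) rfl]
    have hco : coindepSum M s = 1 := by
      classical
      rw [coindepSum, Finset.sum_eq_single ∅]
      · simp
      · intro t ht hne
        rw [Finset.mem_filter, coindep_iff_exists_finset hE] at ht
        obtain ⟨-, htE, J, hJ, hJi, hJc⟩ := ht
        have h1 := Finset.card_le_card hJ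
        have h2 := Finset.card_sdiff_add_card_eq_card htE
        have h3 := Finset.card_pos.2 (Finset.nonempty_iff_ne_empty.2 hne)
        omega
      · intro h
        refine (h ?_).elim
        have hc : M.Coindep ∅ := M✶.empty_indep
        simp [hc]
    rw [hco, ← two_mul, pow_mul]
    simp
  rw [Finset.sum_congr rfl hterm, hrk]
  have := Finset.add_sum_erase E.powerset (fun s ↦ (X : ℤ[X]) ^ s.card)
    (Finset.empty_mem_powerset E)
  rw [Finset.sum_powerset_pow_card, Finset.card_empty, pow_zero] at this
  rw [this]
  exact IsPalindromic.one_add_X_pow _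

lemma inverseKLPoly_restrict_of_indep (h : M.Indep E) :
    inverseKLPoly (M ↾ (E : Set α)) = 1 :=
  inverseKLPoly_of_indep_ground (E := E) rfl
    (by rw [Matroid.restrict_indep_iff]; exact ⟨h, subset_rfl⟩)

/-! ### Polynomials of a circuit with coloops. -/

namespace HasUniqueCircuit

lemma matroidRank_eq (h : HasUniqueCircuit M C D) : matroidRank M = (C ∪ D).card - 1 := by
  obtain ⟨c, hc⟩ := h.nonempty
  have hc' : c ∈ C ∪ D := Finset.mem_union_left _ hc
  rw [matroidRank_eq_card (h.indep_erase hc), Finset.card_erase_of_mem hc']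
  intro J hJ
  have := h.card_lt hJ
  rw [Finset.card_erase_of_mem hc']
  omega

/-- The corank is one, and removing an element of `D` alone leaves the circuit intact. -/
lemma coindep_iff (h : HasUniqueCircuit M C D) (t : Finset α) :
    M.Coindep t ↔ t ⊆ C ∧ t.card ≤ 1 := by
  rw [coindep_iff_exists_finset h.ground, h.matroidRank_eq]
  have hpos : 0 < (C ∪ D).card := Finset.card_pos.2 (h.nonempty.mono Finset.subset_union_left)
  constructor
  · rintro ⟨ht, J, hJ, hJi, hJc⟩
    have h1 := Finset.card_le_card hJ
    have h2 := Finset.card_sdiff_add_card_eq_card ht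
    refine ⟨fun x hx ↦ ?_, by omega⟩
    by_contra hxC
    have h3 : J = (C ∪ D) \ t := Finset.eq_of_subset_of_card_le hJ (by
      have := Finset.card_pos.2 ⟨x, hx⟩
      omega)
    rw [h.indep_iff] at hJi
    refine hJi.2 fun y hy ↦ ?_
    rw [h3, Finset.mem_sdiff]
    refine ⟨Finset.mem_union_left _ hy, fun hyt ↦ ?_⟩
    have := Finset.card_le_one.1 (show t.card ≤ 1 by omega) x hx y hyt
    exact hxC (this ▸ hy)
  · rintro ⟨htC, ht⟩
    refine ⟨htC.trans Finset.subset_union_left, ?_⟩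
    obtain ⟨c, hc, htc⟩ := Finset.exists_subset_singleton_of_card_le_one h.nonempty htC ht
    refine ⟨(C ∪ D).erase c, ?_, h.indep_erase hc, ?_⟩
    · rw [Finset.erase_eq]
      exact Finset.sdiff_subset_sdiff subset_rfl htc
    · rw [Finset.card_erase_of_mem (Finset.mem_union_left _ hc)]

lemma coindepSum_eq (h : HasUniqueCircuit M C D) {v w : Finset α} (hv : v ⊆ C) (hw : w ⊆ D) :
    coindepSum M (v ∪ w) = 1 - v.card := by
  rw [← sum_powerset_filter_card_le_one, coindepSum]
  refine Finset.sum_congr ?_ fun _ _ ↦ rfl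
  ext t
  simp only [Finset.mem_filter, Finset.mem_powerset, h.coindep_iff]
  constructor
  · rintro ⟨h1, h2, h3⟩
    refine ⟨fun x hx ↦ ?_, h3⟩
    exact (Finset.mem_union.1 (h1 hx)).resolve_right fun hxw ↦
      Finset.disjoint_left.1 h.disjoint (h2 hx) (hw hxw)
  · rintro ⟨h1, h2⟩
    exact ⟨h1.trans Finset.subset_union_left, h1.trans hv, h2⟩

/-- Removing an element of `C` leaves an independent set, so the restriction contributes `1`. The
total sign exponent is odd and turns `1 - |v|` into `|v| - 1`. -/
lemma inverseZTerm_of_nonempty (h : HasUniqueCircuit M C D) {v w : Finset α} (hv : v ⊆ C)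
    (hw : w ⊆ D) (hv0 : v.Nonempty) :
    inverseZTerm M (C ∪ D) (v ∪ w) =
      X ^ w.card * (((v.card - 1 : ℕ) : ℤ[X]) * X ^ (v.card - 1)) := by
  have hvw : v ∪ w ⊆ C ∪ D := Finset.union_subset_union hv hw
  have hdis : Disjoint v w := h.disjoint.mono hv hw
  obtain ⟨x, hx⟩ := hv0
  have hind : M.Indep ((C ∪ D) \ (v ∪ w) : Finset α) := by
    rw [h.indep_iff]
    refine ⟨Finset.sdiff_subset, fun h' ↦ ?_⟩
    have := h' (hv hx)
    simp [hx] at this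
  have hc := Finset.card_sdiff_add_card_eq_card hvw
  have hpos := Finset.card_pos.2 ⟨x, hx⟩
  rw [inverseZTerm, inverseKLPoly_restrict_of_indep hind, toNat_eRk_eq_card hind,
    h.matroidRank_eq, h.coindepSum_eq hv hw]
  rw [Finset.card_union_of_disjoint hdis] at hc ⊢
  obtain ⟨k, hk⟩ : ∃ k, v.card = k + 1 := ⟨v.card - 1, by omega⟩
  rw [hk] at hc ⊢
  rw [show (C ∪ D).card - 1 - ((C ∪ D) \ (v ∪ w)).card = k + w.card by omega,
    show k + w.card + (k + 1 + w.card) = 2 * (k + w.card) + 1 by ring, pow_succ, pow_mul,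
    Nat.add_sub_cancel]
  simp
  ring

lemma inverseZTerm_empty_union (h : HasUniqueCircuit M C D) {w : Finset α} (hw : w ⊆ D) :
    inverseZTerm M (C ∪ D) (∅ ∪ w) =
      X ^ w.card * inverseKLPoly (M ↾ ((C ∪ D \ w : Finset α) : Set α)) := by
  have hE : (C ∪ D) \ (∅ ∪ w) = C ∪ D \ w := by
    rw [Finset.empty_union, Finset.union_sdiff_distrib, Finset.sdiff_eq_self_of_disjoint]
    exact h.disjoint.mono_right hw
  have h' := h.restrict (D' := D \ w) Finset.sdiff_subset
  have hr : (M.eRk ((C ∪ D \ w : Finset α) : Set α)).toNat = (C ∪ D \ w).card - 1 :=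
    h'.matroidRank_eq
  have hc := Finset.card_sdiff_add_card_eq_card hw
  have hpos := Finset.card_pos.2 h.nonempty
  rw [inverseZTerm, hE, hr, h.coindepSum_eq (Finset.empty_subset _) hw, h.matroidRank_eq,
    Finset.empty_union, Finset.card_union_of_disjoint h.disjoint,
    Finset.card_union_of_disjoint h'.disjoint,
    show C.card + D.card - 1 - (C.card + (D \ w).card - 1) = w.card by omega, ← two_mul, pow_mul]
  simp

lemma add_sum_inverseZTerm (h : HasUniqueCircuit M C D)
    (hQ : ∀ w ⊆ D, w ≠ ∅ →
      inverseKLPoly (M ↾ ((C ∪ D \ w : Finset α) : Set α)) = circuitQ C.card) :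
    circuitQ C.card + ∑ s ∈ (C ∪ D).powerset.erase ∅, inverseZTerm M (C ∪ D) s =
      (circuitQ C.card + circuitSum C.card) * (1 + X) ^ D.card := by
  -- Replacing the term at `∅` by the candidate lets the sum run over all subsets and split along
  -- `C` and `D`.
  have h1 := Finset.add_sum_erase (C ∪ D).powerset
    (fun s ↦ if s = ∅ then circuitQ C.card else inverseZTerm M (C ∪ D) s)
    (Finset.empty_mem_powerset _)
  simp only [if_true] at h1
  rw [Finset.sum_congr rfl (g := inverseZTerm M (C ∪ D))] at h1
  swap
  · intro s hs
    rw [if_neg (Finset.mem_erase.1 hs).1]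
  rw [h1, sum_powerset_union h.disjoint, ← sum_powerset_circuitSum,
    ← Finset.sum_powerset_pow_card]
  have h2 : ∑ t ∈ C.powerset, (if t = ∅ then circuitQ C.card else 0) = circuitQ C.card := by
    rw [Finset.sum_ite_eq' C.powerset ∅, if_pos (Finset.empty_mem_powerset _)]
  conv_rhs => rw [← h2]
  rw [← Finset.sum_add_distrib, Finset.sum_mul]
  refine Finset.sum_congr rfl fun v hv ↦ ?_
  rw [Finset.mul_sum]
  refine Finset.sum_congr rfl fun w hw ↦ ?_
  rw [Finset.mem_powerset] at hv hw
  rcases v.eq_empty_or_nonempty with rfl | hv0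
  · rw [h.inverseZTerm_empty_union hw]
    rcases eq_or_ne w ∅ with rfl | hw0
    · simp
    · rw [if_neg (by simpa using hw0), hQ w hw hw0]
      simp [mul_comm]
  · rw [if_neg, if_neg hv0.ne_empty, h.inverseZTerm_of_nonempty hv hw hv0]
    · ring
    · intro h'
      rw [Finset.union_eq_empty] at h'
      exact hv0.ne_empty h'.1

/-- Coloops only multiply the inverse `Z`-polynomial by `(1 + x) ^ |D|`, which preserves
palindromicity without changing `Q`. A one-element circuit is a loop, in agreement with `circuitQ 1
= 0`. -/
lemma inverseKLPoly_eq (h : HasUniqueCircuit M C D) : inverseKLPoly M = circuitQ C.card := by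
  induction hn : D.card using Nat.strong_induction_on generalizing D M with
  | _ n ih =>
  subst hn
  have hpos := Finset.card_pos.2 h.nonempty
  rcases Nat.lt_or_ge C.card 2 with h2 | h2
  · have h1 : C.card = 1 := by omega
    rw [inverseKLPoly_of_not_loopless (h.not_loopless h1), h1, circuitQ_one]
  have hr := h.matroidRank_eq
  rw [Finset.card_union_of_disjoint h.disjoint] at hr
  refine _root_.inverseKLPoly_eq h.ground (h.loopless h2) (by omega) ?_ ?_
  · intro i hi
    exact coeff_circuitQ_eq_zero (by omega)
  rw [h.add_sum_inverseZTerm, hr]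
  · have := (isPalindromic_circuitY C.card).mul (IsPalindromic.one_add_X_pow D.card)
    rwa [show C.card - 1 + D.card = C.card + D.card - 1 by omega] at this
  · intro w hw hw0
    refine ih (D \ w).card ?_ (h.restrict Finset.sdiff_subset) rfl
    have h1 := Finset.card_sdiff_add_card_eq_card hw
    have h2 := Finset.card_pos.2 (Finset.nonempty_iff_ne_empty.2 hw0)
    omega

lemma inverseZPoly_eq (h : HasUniqueCircuit M C ∅) :
    inverseZPoly M = circuitQ C.card + circuitSum C.card := by
  rcases Nat.lt_or_ge C.card 2 with h2 | h2
  · have h1 : C.card = 1 := by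
      have hpos := Finset.card_pos.2 h.nonempty
      omega
    rw [inverseZPoly_of_not_loopless (h.not_loopless h1), h1, circuitQ_one]
    simp [circuitSum]
  rw [_root_.inverseZPoly_eq h.ground, h.inverseKLPoly_eq, h.add_sum_inverseZTerm]
  · simp
  · intro w hw hw0
    exact (hw0 (Finset.subset_empty.1 hw)).elim

lemma contract (h : HasUniqueCircuit M C ∅) {t : Finset α} (ht : t ⊂ C) :
    HasUniqueCircuit (M ／ (t : Set α)) (C \ t) ∅ where
  ground := by
    rw [Matroid.contract_ground, h.ground]
    simp
  disjoint := by simp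
  nonempty := by
    rw [Finset.sdiff_nonempty]
    exact ht.2
  indep_iff I := by
    have hind : M.Indep t := by
      rw [h.indep_iff]
      exact ⟨by simpa using ht.1, ht.2⟩
    rw [hind.contract_indep_iff, ← Finset.coe_union, h.indep_iff, Finset.disjoint_coe,
      Finset.union_empty, Finset.union_empty, Finset.subset_sdiff, Finset.union_subset_iff]
    have h1 := ht.1
    have h2 : C \ t ⊆ I ↔ C ⊆ I ∪ t := by
      rw [Finset.union_comm]
      exact sdiff_le_iff
    tauto

/-- Contracting a proper subset of a circuit leaves a smaller circuit, so induction reduces the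
claim to `isPalindromic_circuitZ`. -/
lemma klPoly_eq (h : HasUniqueCircuit M C ∅) : klPoly M = circuitP C.card := by
  induction hn : C.card using Nat.strong_induction_on generalizing C M with
  | _ n ih =>
  subst hn
  have hpos := Finset.card_pos.2 h.nonempty
  rcases Nat.lt_or_ge C.card 2 with h2 | h2
  · have h1 : C.card = 1 := by omega
    rw [klPoly_of_not_loopless (h.not_loopless h1), h1, circuitP_one]
  have hr := h.matroidRank_eq
  have hE := h.ground
  rw [Finset.union_empty] at hr hE
  refine _root_.klPoly_eq hE (h.loopless h2) (by omega) ?_ ?_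
  · intro i hi
    exact coeff_circuitP_eq_zero (by omega)
  -- The flat `t = C` is exceptional: its rank is `|C| - 1`, and the contraction is empty with `P =
  -- 1`, whereas `circuitP 0 = 0`.
  have hterm : ∀ t ∈ C.powerset.erase ∅, X ^ (M.eRk t).toNat * klPoly (M ／ (t : Set α)) =
      X ^ t.card * circuitP (C \ t).card + if t = C then X ^ (C.card - 1) else 0 := by
    intro t ht
    rw [Finset.mem_erase, Finset.mem_powerset] at ht
    rcases eq_or_ne t C with rfl | htC
    · have h1 : M.eRk (t : Set α) = M.eRank := by rw [← hE, Matroid.eRk_ground]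
      have hE' : (M ／ (t : Set α)).E = ∅ := by rw [Matroid.contract_ground, hE, sdiff_self]
      have hk : klPoly (M ／ (t : Set α)) = 1 := by
        rw [Matroid.ground_eq_empty_iff] at hE'
        rw [hE']
        refine klPoly_of_rank_eq_zero ?_ ?_
        · exact loopless_of_forall_indep_singleton fun e he ↦ he.elim
        · simp [matroidRank]
      rw [hk, h1, if_pos rfl, Finset.sdiff_self, Finset.card_empty, circuitP_zero, ← hr,
        matroidRank]
      ring
    · have hss : t ⊂ C := Finset.ssubset_iff_subset_ne.2 ⟨ht.2, htC⟩
      have hind : M.Indep t := by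
        rw [h.indep_iff]
        exact ⟨by simpa using hss.1, hss.2⟩
      have h1 := Finset.card_sdiff_add_card_eq_card ht.2
      have h3 := Finset.card_pos.2 (Finset.nonempty_iff_ne_empty.2 ht.1)
      rw [if_neg htC, add_zero, toNat_eRk_eq_card hind,
        ih (C \ t).card (by omega) (h.contract hss) rfl]
  rw [Finset.sum_congr rfl hterm, Finset.sum_add_distrib,
    Finset.sum_ite_eq' (C.powerset.erase ∅) C, if_pos (by
      rw [Finset.mem_erase]; exact ⟨h.nonempty.ne_empty, by simp⟩), ← add_assoc, hr]
  have h1 := Finset.add_sum_erase C.powerset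
    (fun t ↦ (X : ℤ[X]) ^ t.card * circuitP (C \ t).card) (Finset.empty_mem_powerset C)
  simp only [Finset.card_empty, pow_zero, Finset.sdiff_empty, one_mul] at h1
  rw [h1, add_comm]
  convert isPalindromic_circuitZ h2 using 2
  refine Finset.sum_nbij' (fun t ↦ C \ t) (fun t ↦ C \ t) (by simp) (by simp) ?_ ?_ ?_
  · exact fun t ht ↦ Finset.sdiff_sdiff_eq_self (Finset.mem_powerset.1 ht)
  · exact fun t ht ↦ Finset.sdiff_sdiff_eq_self (Finset.mem_powerset.1 ht)
  · intro t ht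
    rw [Finset.sdiff_sdiff_eq_self (Finset.mem_powerset.1 ht)]

lemma klTau_eq (h : HasUniqueCircuit M C ∅) : klTau M = circuitTau C.card := by
  have hr := h.matroidRank_eq
  rw [Finset.union_empty] at hr
  rw [klTau, circuitTau, hr, h.klPoly_eq]
  split_ifs with hodd
  · exact coeff_circuitP_half hodd
  · rfl

end HasUniqueCircuit

end Classes

/-! ### Two circuits glued along an element -/

/-- The inverse Kazhdan-Lusztig polynomial of two circuits with `p + 1` and `r + 1` elements
that are glued along an element. -/
noncomputable def thetaQ (p r : ℕ) : ℤ[X] :=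
  circuitQ (p + r) + (1 + X) * circuitQ p * circuitQ r -
    (C (circuitTau p) * X ^ (p / 2) * circuitQ r + C (circuitTau r) * X ^ (r / 2) * circuitQ p)

/-- The inverse `Z`-polynomial of two circuits with `p + 1` and `r + 1` elements that are glued
along an element. -/
noncomputable def thetaY (p r : ℕ) : ℤ[X] :=
  circuitQ (p + r) + circuitSum (p + r) +
    (1 + X) * (circuitQ p + circuitSum p) * (circuitQ r + circuitSum r) -
    (C (circuitTau p) * X ^ (p / 2) * (circuitQ r + circuitSum r) +
      C (circuitTau r) * X ^ (r / 2) * (circuitQ p + circuitSum p))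

/-- The left-hand side is the subset sum found in `IsTheta.add_sum_inverseZTerm`. After
`circuitQ_succ`, the two sides differ exactly by `circuitSum_add`. -/
lemma thetaY_eq {p r : ℕ} (hp : 1 ≤ p) (hr : 1 ≤ r) :
    thetaQ p r + circuitSum p * circuitSum r + circuitQ (p + 1) * circuitSum r +
      circuitQ (r + 1) * circuitSum p + X * cardSum p * cardSum r = thetaY p r := by
  rw [thetaQ, thetaY, circuitQ_succ hp, circuitQ_succ hr]
  linear_combination - circuitSum_add p r

lemma circuitTau_eq_zero {m : ℕ} (hm : 1 ≤ m) (h : ¬ Even m) : circuitTau m = 0 := by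
  rw [circuitTau, if_neg]
  rintro ⟨k, hk⟩
  exact h ⟨k + 1, by omega⟩

lemma coeff_tau_mul_circuitQ_eq_zero {p r i : ℕ} (hp : 1 ≤ p) (hr : 1 ≤ r)
    (hi : p + r - 1 ≤ 2 * i) :
    (C (circuitTau p) * X ^ (p / 2) * circuitQ r).coeff i = 0 := by
  by_cases hev : Even p
  · obtain ⟨k, hk⟩ := hev
    -- For `r = 1` the degree bound `(r - 2) / 2` truncates to `0` and is too weak, but then
    -- `circuitQ r` is `0`.
    rcases hr.eq_or_lt with rfl | hr
    · simp [circuitQ_one]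
    · refine coeff_eq_zero_of_natDegree_lt ?_
      have h1 := natDegree_circuitQ_le r
      have h2 := natDegree_C_mul_X_pow_le (circuitTau p) (p / 2)
      have h3 := natDegree_mul_le (p := C (circuitTau p) * X ^ (p / 2)) (q := circuitQ r)
      omega
  · simp [circuitTau_eq_zero hp hev]

lemma coeff_thetaQ_eq_zero {p r i : ℕ} (hp : 1 ≤ p) (hr : 1 ≤ r) (hi : p + r - 1 ≤ 2 * i) :
    (thetaQ p r).coeff i = 0 := by
  rw [thetaQ, coeff_sub, coeff_add, coeff_add, coeff_circuitQ_eq_zero hi,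
    coeff_tau_mul_circuitQ_eq_zero hp hr hi, coeff_tau_mul_circuitQ_eq_zero hr hp (by omega),
    coeff_eq_zero_of_natDegree_lt]
  · simp
  rcases hp.eq_or_lt with rfl | hp
  · simp only [circuitQ_one, mul_zero, zero_mul, natDegree_zero]
    omega
  rcases hr.eq_or_lt with rfl | hr
  · simp only [circuitQ_one, mul_zero, natDegree_zero]
    omega
  have h1 := natDegree_circuitQ_le r
  have h2 := natDegree_circuitQ_le p
  have h3 := natDegree_mul_le (p := (1 + X) * circuitQ p) (q := circuitQ r)
  have h4 := natDegree_mul_le (p := 1 + X) (q := circuitQ p)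
  have h5 := IsPalindromic.one_add_X.1
  omega

lemma isPalindromic_tau_mul_circuitY {p r : ℕ} (hp : 1 ≤ p) (hr : 1 ≤ r) :
    IsPalindromic (p + r - 1)
      (C (circuitTau p) * X ^ (p / 2) * (circuitQ r + circuitSum r)) := by
  by_cases hev : Even p
  · obtain ⟨k, hk⟩ := hev
    have := ((IsPalindromic.X_pow (p / 2)).C_mul (circuitTau p)).mul (isPalindromic_circuitY r)
    rwa [show 2 * (p / 2) + (r - 1) = p + r - 1 by omega] at this
  · simpa [circuitTau_eq_zero hp hev] using IsPalindromic.zero _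

lemma isPalindromic_thetaY {p r : ℕ} (hp : 1 ≤ p) (hr : 1 ≤ r) :
    IsPalindromic (p + r - 1) (thetaY p r) := by
  have h1 := (IsPalindromic.one_add_X.mul (isPalindromic_circuitY p)).mul
    (isPalindromic_circuitY r)
  rw [show 1 + (p - 1) + (r - 1) = p + r - 1 by omega] at h1
  have h2 := isPalindromic_tau_mul_circuitY hr hp
  rw [add_comm r p] at h2
  exact ((isPalindromic_circuitY (p + r)).add h1).sub
    ((isPalindromic_tau_mul_circuitY hp hr).add h2)

section Theta

variable {α : Type*} [DecidableEq α] {M : Matroid α} {A B : Finset α} {e : α}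

/-- The matroid `M` consists of the circuits `A ∪ {e}` and `B ∪ {e}`, glued along `e`: its circuits
are `A ∪ {e}`, `B ∪ {e}` and `A ∪ B`. -/
structure IsTheta (M : Matroid α) (A B : Finset α) (e : α) : Prop where
  ground : M.E = (insert e (A ∪ B) : Finset α)
  disjoint : Disjoint A B
  notMem_left : e ∉ A
  notMem_right : e ∉ B
  nonempty_left : A.Nonempty
  nonempty_right : B.Nonempty
  indep_iff : ∀ I : Finset α, M.Indep I ↔
    I ⊆ insert e (A ∪ B) ∧ ¬ insert e A ⊆ I ∧ ¬ insert e B ⊆ I ∧ ¬ A ∪ B ⊆ I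

namespace IsTheta

lemma symm (h : IsTheta M A B e) : IsTheta M B A e where
  ground := by rw [Finset.union_comm]; exact h.ground
  disjoint := h.disjoint.symm
  notMem_left := h.notMem_right
  notMem_right := h.notMem_left
  nonempty_left := h.nonempty_right
  nonempty_right := h.nonempty_left
  indep_iff I := by
    rw [h.indep_iff, Finset.union_comm]
    tauto

lemma notMem_union (h : IsTheta M A B e) : e ∉ A ∪ B := by
  simp [h.notMem_left, h.notMem_right]

lemma card_ground (h : IsTheta M A B e) : (insert e (A ∪ B)).card = A.card + B.card + 1 := by
  rw [Finset.card_insert_of_notMem h.notMem_union, Finset.card_union_of_disjoint h.disjoint]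

/-- A set is independent if its complement contains elements of both `A` and `B`. -/
lemma indep_sdiff_of_mem (h : IsTheta M A B e) {a b : α} (ha : a ∈ A) (hb : b ∈ B) {s : Finset α}
    (has : a ∈ s) (hbs : b ∈ s) : M.Indep (insert e (A ∪ B) \ s : Finset α) := by
  rw [h.indep_iff]
  refine ⟨Finset.sdiff_subset, fun h' ↦ ?_, fun h' ↦ ?_, fun h' ↦ ?_⟩
  · exact (Finset.mem_sdiff.1 (h' (Finset.mem_insert_of_mem ha))).2 has
  · exact (Finset.mem_sdiff.1 (h' (Finset.mem_insert_of_mem hb))).2 hbs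
  · exact (Finset.mem_sdiff.1 (h' (Finset.mem_union_left _ ha))).2 has

/-- A set is independent if its complement contains `e` and an element of `A ∪ B`. -/
lemma indep_sdiff_of_mem_union (h : IsTheta M A B e) {a : α} (ha : a ∈ A ∪ B) {s : Finset α}
    (has : a ∈ s) (hes : e ∈ s) : M.Indep (insert e (A ∪ B) \ s : Finset α) := by
  rw [h.indep_iff]
  refine ⟨Finset.sdiff_subset, fun h' ↦ ?_, fun h' ↦ ?_, fun h' ↦ ?_⟩
  · exact (Finset.mem_sdiff.1 (h' (Finset.mem_insert_self _ _))).2 hes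
  · exact (Finset.mem_sdiff.1 (h' (Finset.mem_insert_self _ _))).2 hes
  · exact (Finset.mem_sdiff.1 (h' ha)).2 has

/-- An independent set misses a point of each of the three circuits, and no single point lies on all
three. -/
lemma card_add_two_le (h : IsTheta M A B e) {J : Finset α} (hJ : M.Indep J) :
    J.card + 2 ≤ A.card + B.card + 1 := by
  rw [h.indep_iff] at hJ
  obtain ⟨hJE, h1, h2, h3⟩ := hJ
  obtain ⟨x, hx, hxJ⟩ := Finset.not_subset.1 h1
  obtain ⟨y, hy, hyJ⟩ := Finset.not_subset.1 h2
  obtain ⟨z, hz, hzJ⟩ := Finset.not_subset.1 h3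
  have hc := Finset.card_sdiff_add_card_eq_card hJE
  rw [h.card_ground] at hc
  by_contra! hlt
  have hle : (insert e (A ∪ B) \ J).card ≤ 1 := by omega
  have hmem : ∀ w ∉ J, w ∈ insert e (A ∪ B) → w ∈ insert e (A ∪ B) \ J :=
    fun w h1 h2 ↦ Finset.mem_sdiff.2 ⟨h2, h1⟩
  have hx' := hmem x hxJ (by simp at hx ⊢; tauto)
  have hy' := hmem y hyJ (by simp at hy ⊢; tauto)
  have hz' := hmem z hzJ (by simp at hz ⊢; tauto)
  obtain rfl := Finset.card_le_one.1 hle x hx' y hy'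
  obtain rfl := Finset.card_le_one.1 hle x hx' z hz'
  have hd : x ∈ A → x ∉ B := fun hA ↦ Finset.disjoint_left.1 h.disjoint hA
  have he := h.notMem_union
  rw [Finset.mem_insert] at hx hy
  rcases hx with rfl | hx
  · exact he hz
  · rcases hy with rfl | hy
    · exact he hz
    · exact hd hx hy

lemma loopless (h : IsTheta M A B e) : M.Loopless := by
  refine loopless_of_forall_indep_singleton fun x hx ↦ ?_
  have hi := h.indep_iff {x}
  rw [Finset.coe_singleton] at hi
  rw [hi]
  rw [h.ground] at hx
  have hA := Finset.card_pos.2 h.nonempty_left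
  have hB := Finset.card_pos.2 h.nonempty_right
  refine ⟨by simpa using hx, fun h' ↦ ?_, fun h' ↦ ?_, fun h' ↦ ?_⟩ <;>
  have := Finset.card_le_card h'
  · rw [Finset.card_singleton, Finset.card_insert_of_notMem h.notMem_left] at this
    omega
  · rw [Finset.card_singleton, Finset.card_insert_of_notMem h.notMem_right] at this
    omega
  · rw [Finset.card_singleton, Finset.card_union_of_disjoint h.disjoint] at this
    omega

/-- Deleting part of `B` breaks both circuits through `B`; the rest of `B` becomes coloops. -/
lemma restrict (h : IsTheta M A B e) {w : Finset α} (hw : w ⊆ B) (hw0 : w.Nonempty) :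
    HasUniqueCircuit (M ↾ ((insert e A ∪ B \ w : Finset α) : Set α)) (insert e A) (B \ w) where
  ground := rfl
  disjoint := by
    rw [Finset.disjoint_insert_left]
    exact ⟨fun h' ↦ h.notMem_right (Finset.sdiff_subset h'),
      h.disjoint.mono_right Finset.sdiff_subset⟩
  nonempty := Finset.insert_nonempty _ _
  indep_iff I := by
    obtain ⟨b, hb⟩ := hw0
    have hbB := hw hb
    have hbe : b ≠ e := fun h' ↦ h.notMem_right (h' ▸ hbB)
    have hbA : b ∉ A := Finset.disjoint_right.1 h.disjoint hbB
    rw [Matroid.restrict_indep_iff, h.indep_iff, Finset.coe_subset]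
    constructor
    · rintro ⟨⟨-, h1, -⟩, h2⟩
      exact ⟨h2, h1⟩
    · rintro ⟨h1, h2⟩
      have hbI : b ∉ I := fun hbI ↦ by
        have := h1 hbI
        simp [hbe, hbA, hb] at this
      refine ⟨⟨fun x hx ↦ ?_, h2, fun h' ↦ hbI (h' (Finset.mem_insert_of_mem hbB)),
        fun h' ↦ hbI (h' (Finset.mem_union_right _ hbB))⟩, h1⟩
      have := h1 hx
      simp at this ⊢
      tauto

end IsTheta

variable [Fintype α]

/-! ### Coindependent sets and polynomials of two glued circuits. -/

namespace IsTheta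

lemma matroidRank_eq (h : IsTheta M A B e) : matroidRank M = A.card + B.card - 1 := by
  obtain ⟨a, ha⟩ := h.nonempty_left
  obtain ⟨b, hb⟩ := h.nonempty_right
  have hab : a ≠ b := fun h' ↦ Finset.disjoint_left.1 h.disjoint ha (h' ▸ hb)
  have hss : {a, b} ⊆ insert e (A ∪ B) := by
    intro x hx
    simp at hx ⊢
    rcases hx with rfl | rfl <;> tauto
  have hc := Finset.card_sdiff_add_card_eq_card hss
  rw [h.card_ground, Finset.card_pair hab] at hc
  rw [matroidRank_eq_card (h.indep_sdiff_of_mem (s := {a, b}) ha hb (by simp) (by simp))]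
  · omega
  · intro J hJ
    have := h.card_add_two_le hJ
    omega

/-- The corank is two. If `t` had two elements in `A`, it would consist of them, and its complement
would be a basis containing the circuit `insert e B`. -/
lemma card_inter_le_one_of_coindep (h : IsTheta M A B e) {t : Finset α} (ht : M.Coindep t) :
    t.card ≤ 2 ∧ (t ∩ A).card ≤ 1 := by
  rw [coindep_iff_exists_finset h.ground, h.matroidRank_eq] at ht
  obtain ⟨ht, J, hJ, hJi, hJc⟩ := ht
  have h1 := Finset.card_le_card hJ
  have h2 := Finset.card_sdiff_add_card_eq_card ht
  rw [h.card_ground] at h2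
  have hA := Finset.card_pos.2 h.nonempty_left
  refine ⟨by omega, ?_⟩
  by_contra! hlt
  have h3 : t ∩ A = t := Finset.eq_of_subset_of_card_le Finset.inter_subset_left (by omega)
  have h4 : J = insert e (A ∪ B) \ t := Finset.eq_of_subset_of_card_le hJ (by
    rw [h3] at hlt
    omega)
  rw [h.indep_iff] at hJi
  refine hJi.2.2.1 fun y hy ↦ ?_
  rw [h4, Finset.mem_sdiff]
  refine ⟨?_, fun hyt ↦ ?_⟩
  · simp at hy ⊢
    tauto
  · rw [← h3, Finset.mem_inter] at hyt
    rcases Finset.mem_insert.1 hy with rfl | hyB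
    · exact h.notMem_left hyt.2
    · exact Finset.disjoint_left.1 h.disjoint hyt.2 hyB

lemma coindep_of_subset (h : IsTheta M A B e) {t s : Finset α} (hts : t ⊆ s)
    (hs : s ⊆ insert e (A ∪ B)) (hc : s.card = 2)
    (hi : M.Indep (insert e (A ∪ B) \ s : Finset α)) : M.Coindep t := by
  rw [coindep_iff_exists_finset h.ground, h.matroidRank_eq]
  refine ⟨hts.trans hs, _, Finset.sdiff_subset_sdiff subset_rfl hts, hi, ?_⟩
  have h2 := Finset.card_sdiff_add_card_eq_card hs
  rw [h.card_ground] at h2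
  omega

lemma coindep_union_iff (h : IsTheta M A B e) {x y : Finset α} (hx : x ⊆ A) (hy : y ⊆ B) :
    M.Coindep (x ∪ y : Finset α) ↔ x.card ≤ 1 ∧ y.card ≤ 1 := by
  have hAx : (x ∪ y) ∩ A = x := by
    rw [Finset.union_inter_distrib_right, Finset.inter_eq_left.2 hx,
      Finset.disjoint_iff_inter_eq_empty.1 (h.disjoint.symm.mono_left hy), Finset.union_empty]
  have hBy : (x ∪ y) ∩ B = y := by
    rw [Finset.union_inter_distrib_right, Finset.inter_eq_left.2 hy,
      Finset.disjoint_iff_inter_eq_empty.1 (h.disjoint.mono_left hx), Finset.empty_union]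
  constructor
  · intro hco
    have h1 := (h.card_inter_le_one_of_coindep hco).2
    have h2 := (h.symm.card_inter_le_one_of_coindep hco).2
    rw [hAx] at h1
    rw [hBy] at h2
    exact ⟨h1, h2⟩
  · rintro ⟨h1, h2⟩
    obtain ⟨a, ha, hxa⟩ := Finset.exists_subset_singleton_of_card_le_one h.nonempty_left hx h1
    obtain ⟨b, hb, hyb⟩ := Finset.exists_subset_singleton_of_card_le_one h.nonempty_right hy h2
    have hab : a ≠ b := fun h' ↦ Finset.disjoint_left.1 h.disjoint ha (h' ▸ hb)
    refine h.coindep_of_subset (s := {a} ∪ {b}) (Finset.union_subset_union hxa hyb) ?_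
      (Finset.card_pair hab) (h.indep_sdiff_of_mem ha hb (by simp) (by simp))
    intro z hz
    simp at hz ⊢
    rcases hz with rfl | rfl <;> tauto

lemma coindep_insert_iff (h : IsTheta M A B e) {t : Finset α} (ht : t ⊆ A ∪ B) :
    M.Coindep (insert e t : Finset α) ↔ t.card ≤ 1 := by
  have het : e ∉ t := fun h' ↦ h.notMem_union (ht h')
  constructor
  · intro hco
    have h1 := (h.card_inter_le_one_of_coindep hco).1
    rw [Finset.card_insert_of_notMem het] at h1
    omega
  · intro h1
    obtain ⟨a, ha, hta⟩ :=
      Finset.exists_subset_singleton_of_card_le_one (h.nonempty_left.mono Finset.subset_union_left) ht h1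
    have hea : e ≠ a := fun h' ↦ h.notMem_union (h' ▸ ha)
    refine h.coindep_of_subset (s := {e, a}) (Finset.insert_subset_insert _ hta) ?_
      (Finset.card_pair hea) (h.indep_sdiff_of_mem_union ha (by simp) (by simp))
    exact Finset.insert_subset_insert _ (by simpa using ha)

lemma coindepSum_union (h : IsTheta M A B e) {v w : Finset α} (hv : v ⊆ A) (hw : w ⊆ B) :
    coindepSum M (v ∪ w) = (1 - v.card) * (1 - w.card) := by
  classical
  rw [← sum_powerset_filter_card_le_one, ← sum_powerset_filter_card_le_one, coindepSum,
    Finset.sum_filter, sum_powerset_union (h.disjoint.mono hv hw), Finset.sum_filter,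
    Finset.sum_filter, Finset.sum_mul_sum]
  refine Finset.sum_congr rfl fun x hx ↦ Finset.sum_congr rfl fun y hy ↦ ?_
  rw [Finset.mem_powerset] at hx hy
  simp only [h.coindep_union_iff (hx.trans hv) (hy.trans hw)]
  rw [Finset.card_union_of_disjoint (h.disjoint.mono (hx.trans hv) (hy.trans hw)), pow_add,
    ite_and, ite_mul, zero_mul, mul_ite, mul_zero]

/-- Sets avoiding `e` give `(1 - |v|) (1 - |w|)`, those containing `e` give `-(1 - |v| - |w|)`. -/
lemma coindepSum_insert (h : IsTheta M A B e) {v w : Finset α} (hv : v ⊆ A) (hw : w ⊆ B) :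
    coindepSum M (insert e (v ∪ w)) = v.card * w.card := by
  classical
  have hvw : v ∪ w ⊆ A ∪ B := Finset.union_subset_union hv hw
  have he : e ∉ v ∪ w := fun h' ↦ h.notMem_union (hvw h')
  have h1 := h.coindepSum_union hv hw
  have h2 := sum_powerset_filter_card_le_one (v ∪ w)
  rw [Finset.card_union_of_disjoint (h.disjoint.mono hv hw), Finset.sum_filter] at h2
  rw [coindepSum, Finset.sum_filter] at h1 ⊢
  rw [Finset.sum_powerset_insert he, h1]
  have h3 : ∑ t ∈ (v ∪ w).powerset, (if M.Coindep (insert e t : Finset α) then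
      (-1 : ℤ) ^ (insert e t).card else 0) = -(1 - (v.card + w.card : ℕ)) := by
    rw [← h2, ← Finset.sum_neg_distrib]
    refine Finset.sum_congr rfl fun t ht ↦ ?_
    rw [Finset.mem_powerset] at ht
    simp only [h.coindep_insert_iff (ht.trans hvw)]
    rw [Finset.card_insert_of_notMem (fun h' ↦ he (ht h')), pow_succ]
    split_ifs <;> simp
  rw [h3]
  push_cast
  ring

lemma inverseZTerm_union (h : IsTheta M A B e) {v w : Finset α} (hv : v ⊆ A) (hw : w ⊆ B)
    (hv0 : v.Nonempty) (hw0 : w.Nonempty) :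
    inverseZTerm M (insert e (A ∪ B)) (v ∪ w) =
      (((v.card - 1 : ℕ) : ℤ[X]) * X ^ (v.card - 1)) *
        (((w.card - 1 : ℕ) : ℤ[X]) * X ^ (w.card - 1)) := by
  have hvw : v ∪ w ⊆ insert e (A ∪ B) :=
    (Finset.union_subset_union hv hw).trans (Finset.subset_insert _ _)
  have hv1 := Finset.card_pos.2 hv0
  have hw1 := Finset.card_pos.2 hw0
  obtain ⟨a, ha⟩ := hv0
  obtain ⟨b, hb⟩ := hw0
  have hind := h.indep_sdiff_of_mem (s := v ∪ w) (hv ha) (hw hb) (by simp [ha]) (by simp [hb])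
  have hc := Finset.card_sdiff_add_card_eq_card hvw
  rw [h.card_ground] at hc
  rw [inverseZTerm, inverseKLPoly_restrict_of_indep hind, toNat_eRk_eq_card hind,
    h.matroidRank_eq, h.coindepSum_union hv hw]
  rw [Finset.card_union_of_disjoint (h.disjoint.mono hv hw)] at hc ⊢
  obtain ⟨k, hk⟩ : ∃ k, v.card = k + 1 := ⟨v.card - 1, by omega⟩
  obtain ⟨l, hl⟩ : ∃ l, w.card = l + 1 := ⟨w.card - 1, by omega⟩
  rw [hk, hl] at hc ⊢
  rw [show A.card + B.card - 1 - (insert e (A ∪ B) \ (v ∪ w)).card = k + l by omega,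
    show k + l + (k + 1 + (l + 1)) = 2 * (k + l + 1) by ring, pow_mul,
    Nat.add_sub_cancel, Nat.add_sub_cancel]
  simp
  ring

lemma inverseZTerm_right (h : IsTheta M A B e) {w : Finset α} (hw : w ⊆ B) (hw0 : w.Nonempty) :
    inverseZTerm M (insert e (A ∪ B)) w =
      circuitQ (A.card + 1) * (((w.card - 1 : ℕ) : ℤ[X]) * X ^ (w.card - 1)) := by
  have hE : insert e (A ∪ B) \ w = insert e A ∪ B \ w := by
    rw [← Finset.insert_union, Finset.union_sdiff_distrib, Finset.sdiff_eq_self_of_disjoint]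
    rw [Finset.disjoint_insert_left]
    exact ⟨fun h' ↦ h.notMem_right (hw h'), h.disjoint.mono_right hw⟩
  have h' := h.restrict hw hw0
  have hr : (M.eRk ((insert e A ∪ B \ w : Finset α) : Set α)).toNat =
      (insert e A ∪ B \ w).card - 1 := h'.matroidRank_eq
  have hco := h.coindepSum_union (Finset.empty_subset A) hw
  rw [Finset.empty_union] at hco
  have hc := Finset.card_sdiff_add_card_eq_card hw
  have hw1 := Finset.card_pos.2 hw0
  rw [inverseZTerm, hE, hr, hco, h.matroidRank_eq, h'.inverseKLPoly_eq,
    Finset.card_union_of_disjoint h'.disjoint, Finset.card_insert_of_notMem h.notMem_left]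
  obtain ⟨l, hl⟩ : ∃ l, w.card = l + 1 := ⟨w.card - 1, by omega⟩
  rw [hl] at hc ⊢
  rw [show A.card + B.card - 1 - (A.card + 1 + (B \ w).card - 1) = l by omega,
    show l + (l + 1) = 2 * l + 1 by ring, pow_succ, pow_mul, Nat.add_sub_cancel]
  simp
  ring

/-- If `v` or `w` is empty, both sides vanish; otherwise the remaining set is independent and the
sign is even. -/
lemma inverseZTerm_insert (h : IsTheta M A B e) {v w : Finset α} (hv : v ⊆ A) (hw : w ⊆ B) :
    inverseZTerm M (insert e (A ∪ B)) (insert e (v ∪ w)) =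
      X * ((v.card : ℤ[X]) * X ^ (v.card - 1)) * ((w.card : ℤ[X]) * X ^ (w.card - 1)) := by
  have hvw : v ∪ w ⊆ A ∪ B := Finset.union_subset_union hv hw
  have he : e ∉ v ∪ w := fun h' ↦ h.notMem_union (hvw h')
  have hco := h.coindepSum_insert hv hw
  rcases v.eq_empty_or_nonempty with rfl | hv0
  · rw [inverseZTerm, hco]
    simp
  rcases w.eq_empty_or_nonempty with rfl | hw0
  · rw [inverseZTerm, hco]
    simp
  have hv1 := Finset.card_pos.2 hv0
  have hw1 := Finset.card_pos.2 hw0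
  obtain ⟨a, ha⟩ := hv0
  obtain ⟨b, hb⟩ := hw0
  have hind := h.indep_sdiff_of_mem (s := insert e (v ∪ w)) (hv ha) (hw hb) (by simp [ha])
    (by simp [hb])
  have hc := Finset.card_sdiff_add_card_eq_card (Finset.insert_subset_insert e hvw)
  rw [h.card_ground] at hc
  rw [inverseZTerm, inverseKLPoly_restrict_of_indep hind, toNat_eRk_eq_card hind,
    h.matroidRank_eq, hco]
  rw [Finset.card_insert_of_notMem he,
    Finset.card_union_of_disjoint (h.disjoint.mono hv hw)] at hc ⊢
  obtain ⟨k, hk⟩ : ∃ k, v.card = k + 1 := ⟨v.card - 1, by omega⟩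
  obtain ⟨l, hl⟩ : ∃ l, w.card = l + 1 := ⟨w.card - 1, by omega⟩
  rw [hk, hl] at hc ⊢
  rw [show A.card + B.card - 1 - (insert e (A ∪ B) \ insert e (v ∪ w)).card = k + l + 1 by omega,
    show k + l + 1 + (k + 1 + (l + 1) + 1) = 2 * (k + l + 2) by ring, pow_mul,
    Nat.add_sub_cancel, Nat.add_sub_cancel]
  simp
  ring

/-- The subsets `s` split by whether `e ∈ s` and whether `s` meets `A` and `B`. Leaving `q`
arbitrary avoids needing `Q_M` in advance. -/
lemma add_sum_inverseZTerm (h : IsTheta M A B e) (q : ℤ[X]) :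
    q + ∑ s ∈ (insert e (A ∪ B)).powerset.erase ∅, inverseZTerm M (insert e (A ∪ B)) s =
      q + circuitSum A.card * circuitSum B.card + circuitQ (A.card + 1) * circuitSum B.card +
        circuitQ (B.card + 1) * circuitSum A.card + X * cardSum A.card * cardSum B.card := by
  have h1 := Finset.add_sum_erase (insert e (A ∪ B)).powerset
    (fun s ↦ if s = ∅ then q else inverseZTerm M (insert e (A ∪ B)) s)
    (Finset.empty_mem_powerset _)
  simp only [if_true] at h1
  rw [Finset.sum_congr rfl (g := inverseZTerm M (insert e (A ∪ B)))] at h1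
  swap
  · intro s hs
    rw [if_neg (Finset.mem_erase.1 hs).1]
  rw [h1, Finset.sum_powerset_insert h.notMem_union, sum_powerset_union h.disjoint,
    sum_powerset_union h.disjoint]
  have hdelta : ∀ (s : Finset α) (x : ℤ[X]), ∑ t ∈ s.powerset, (if t = ∅ then x else 0) = x :=
    fun s x ↦ by rw [Finset.sum_ite_eq' s.powerset ∅, if_pos (Finset.empty_mem_powerset _)]
  have hins : ∑ v ∈ A.powerset, ∑ w ∈ B.powerset, (if insert e (v ∪ w) = ∅ then q else
      inverseZTerm M (insert e (A ∪ B)) (insert e (v ∪ w))) =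
      X * cardSum A.card * cardSum B.card := by
    rw [← sum_powerset_cardSum, ← sum_powerset_cardSum, Finset.mul_sum A.powerset, Finset.sum_mul_sum]
    refine Finset.sum_congr rfl fun v hv ↦ Finset.sum_congr rfl fun w hw ↦ ?_
    rw [Finset.mem_powerset] at hv hw
    rw [if_neg (Finset.insert_ne_empty _ _), h.inverseZTerm_insert hv hw]
  have hun : ∑ v ∈ A.powerset, ∑ w ∈ B.powerset, (if v ∪ w = ∅ then q else
      inverseZTerm M (insert e (A ∪ B)) (v ∪ w)) =
      ∑ v ∈ A.powerset, ∑ w ∈ B.powerset,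
        ((if v = ∅ then (if w = ∅ then q else 0) else 0) +
          (((v.card - 1 : ℕ) : ℤ[X]) * X ^ (v.card - 1)) *
            (((w.card - 1 : ℕ) : ℤ[X]) * X ^ (w.card - 1)) +
          (if v = ∅ then circuitQ (A.card + 1) else 0) *
            (((w.card - 1 : ℕ) : ℤ[X]) * X ^ (w.card - 1)) +
          (((v.card - 1 : ℕ) : ℤ[X]) * X ^ (v.card - 1)) *
            (if w = ∅ then circuitQ (B.card + 1) else 0)) := by
    refine Finset.sum_congr rfl fun v hv ↦ Finset.sum_congr rfl fun w hw ↦ ?_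
    rw [Finset.mem_powerset] at hv hw
    rcases v.eq_empty_or_nonempty with rfl | hv0
    · rcases w.eq_empty_or_nonempty with rfl | hw0
      · simp
      · rw [Finset.empty_union, if_neg hw0.ne_empty, h.inverseZTerm_right hw hw0]
        simp [hw0.ne_empty]
    · rcases w.eq_empty_or_nonempty with rfl | hw0
      · have := h.symm.inverseZTerm_right hv hv0
        rw [Finset.union_comm] at this
        rw [Finset.union_empty, if_neg hv0.ne_empty, this]
        simp [hv0.ne_empty]
        ring
      · rw [if_neg, h.inverseZTerm_union hv hw hv0 hw0, if_neg hv0.ne_empty,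
          if_neg hv0.ne_empty, if_neg hw0.ne_empty]
        · ring
        · intro h'
          exact hv0.ne_empty (Finset.union_eq_empty.1 h').1
  rw [hins, hun]
  simp only [Finset.sum_add_distrib, ← Finset.sum_mul_sum]
  rw [hdelta, hdelta, sum_powerset_circuitSum, sum_powerset_circuitSum]
  have h0 : ∑ v ∈ A.powerset, ∑ w ∈ B.powerset, (if v = ∅ then (if w = ∅ then q else 0) else 0)
      = q := by
    refine (Finset.sum_congr rfl fun v _ ↦ ?_).trans (hdelta A q)
    split_ifs
    · exact hdelta B q
    · simp
  rw [h0]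
  ring

lemma inverseKLPoly_eq (h : IsTheta M A B e) : inverseKLPoly M = thetaQ A.card B.card := by
  have hA := Finset.card_pos.2 h.nonempty_left
  have hB := Finset.card_pos.2 h.nonempty_right
  have hr := h.matroidRank_eq
  refine _root_.inverseKLPoly_eq h.ground h.loopless (by omega) ?_ ?_
  · intro i hi
    exact coeff_thetaQ_eq_zero hA hB (by omega)
  · rw [h.add_sum_inverseZTerm, thetaY_eq hA hB, hr]
    exact isPalindromic_thetaY hA hB

lemma inverseZPoly_eq (h : IsTheta M A B e) : inverseZPoly M = thetaY A.card B.card := by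
  rw [_root_.inverseZPoly_eq h.ground, h.inverseKLPoly_eq, h.add_sum_inverseZTerm,
    thetaY_eq (Finset.card_pos.2 h.nonempty_left) (Finset.card_pos.2 h.nonempty_right)]

end IsTheta

end Theta

/-! ### Uniform matroids of corank one -/

lemma hasUniqueCircuit_uniformMatroid {m k : ℕ} (hk : 1 ≤ k) (hm : m = k - 1) :
    HasUniqueCircuit (uniformMatroid m k) Finset.univ ∅ where
  ground := by
    rw [Finset.union_empty, Finset.coe_univ]
    rfl
  disjoint := by simp
  nonempty := ⟨⟨0, hk⟩, Finset.mem_univ _⟩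
  indep_iff I := by
    have h1 : (uniformMatroid m k).Indep I ↔ (I : Set (Fin k)).ncard ≤ m := Iff.rfl
    rw [h1, ncard_coe_finset, Finset.univ_subset_iff]
    have h2 := I.card_eq_iff_eq_univ
    rw [Fintype.card_fin] at h2
    have h3 := I.card_le_univ
    rw [Fintype.card_fin] at h3
    rw [← h2]
    simp
    omega

lemma inverseKLPoly_uniformMatroid {m k : ℕ} (hk : 1 ≤ k) (hm : m = k - 1) :
    inverseKLPoly (uniformMatroid m k) = circuitQ k := by
  rw [(hasUniqueCircuit_uniformMatroid hk hm).inverseKLPoly_eq, Finset.card_univ,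
    Fintype.card_fin]

lemma inverseZPoly_uniformMatroid {m k : ℕ} (hk : 1 ≤ k) (hm : m = k - 1) :
    inverseZPoly (uniformMatroid m k) = circuitQ k + circuitSum k := by
  rw [(hasUniqueCircuit_uniformMatroid hk hm).inverseZPoly_eq, Finset.card_univ,
    Fintype.card_fin]

lemma klTau_uniformMatroid {m k : ℕ} (hk : 1 ≤ k) (hm : m = k - 1) :
    klTau (uniformMatroid m k) = circuitTau k := by
  rw [(hasUniqueCircuit_uniformMatroid hk hm).klTau_eq, Finset.card_univ, Fintype.card_fin]

/-! ### Glued cycles -/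

/-- A set `I` of edges is a forest if every edge in `I` is the only edge in `I` between some
set of vertices and its complement. -/
lemma Graph.isForest_of_forall_exists_cut {V β : Type*} {G : Graph V β} {I : Set β}
    (hfin : I.Finite)
    (h : ∀ f ∈ I, ∃ U : Set V, (∃ x y, G.IsLink f x y ∧ x ∈ U ∧ y ∉ U) ∧
      ∀ g ∈ I, g ≠ f → ∀ x y, G.IsLink g x y → x ∈ U → y ∈ U) : G.IsForest I := by
  induction I, hfin using Set.Finite.induction_on with
  | empty => exact G.isForest_empty
  | @insert f I hfI _ ih =>
    have hI : G.IsForest I := ih fun g hg ↦ by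
      obtain ⟨U, h1, h2⟩ := h g (mem_insert_of_mem _ hg)
      exact ⟨U, h1, fun k hk ↦ h2 k (mem_insert_of_mem _ hk)⟩
    obtain ⟨U, ⟨x, y, hxy, hx, hy⟩, hU⟩ := h f (mem_insert _ _)
    rw [Graph.isForest_insert_iff hI hfI hxy]
    rintro ⟨p⟩
    have key : ∀ u v : V, (G.simpleGraphOn I).Walk u v → u ∈ U → v ∈ U := by
      intro u v p
      induction p with
      | nil => exact id
      | cons hadj _ ih =>
        obtain ⟨-, g, hg, hl⟩ := hadj
        exact fun hu ↦ ih (hU g (mem_insert_of_mem _ hg) (fun h' ↦ hfI (h' ▸ hg)) _ _ hl hu)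
    exact hy (key x y p hx)

section GluedCycles

variable {a b : ℕ}

lemma gluedCyclesGraph_isLink_none {x y : ZMod (a + b - 2)} :
    (gluedCyclesGraph a b).IsLink none x y ↔
      s((0 : ZMod (a + b - 2)), ((a - 1 : ℕ) : ZMod (a + b - 2))) = s(x, y) := Iff.rfl

lemma gluedCyclesGraph_isLink_some {j : Fin (a + b - 2)} {x y : ZMod (a + b - 2)} :
    (gluedCyclesGraph a b).IsLink (some j) x y ↔
      s(((j : ℕ) : ZMod (a + b - 2)), ((j : ℕ) : ZMod (a + b - 2)) + 1) = s(x, y) := Iff.rfl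

lemma gluedCycles_indep_iff {I : Set (Option (Fin (a + b - 2)))} :
    (gluedCycles a b).Indep I ↔ (gluedCyclesGraph a b).IsForest I := Iff.rfl

lemma gluedCycles_ground : (gluedCycles a b).E = univ := by
  refine eq_univ_of_forall fun e ↦ ?_
  change e ∈ (gluedCyclesGraph a b).edgeSet
  cases e with
  | none => exact Graph.IsLink.edge_mem (gluedCyclesGraph_isLink_none.2 rfl)
  | some j => exact Graph.IsLink.edge_mem (gluedCyclesGraph_isLink_some.2 rfl)

/-- The vertices `i + 1, …, j` of the glued cycles. -/
def vertexInterval (N i j : ℕ) : Set (ZMod N) := {v | i < v.val ∧ v.val ≤ j}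

lemma mem_vertexInterval_natCast {N i j k : ℕ} (hk : k < N) :
    (k : ZMod N) ∈ vertexInterval N i j ↔ i < k ∧ k ≤ j := by
  rw [vertexInterval, mem_ofPred_eq, ZMod.val_cast_of_lt hk]

/-- Wrapping around does no harm: for `k + 1 = N` the vertex is `0`, which lies in no interval. So
an edge `some k` leaves the interval exactly if `k` is one of its ends `i ≠ j`. -/
lemma mem_vertexInterval_natCast_add_one {N i j k : ℕ} (hk : k < N) (hj : j < N) :
    (k : ZMod N) + 1 ∈ vertexInterval N i j ↔ i ≤ k ∧ k < j := by
  rcases Nat.lt_or_ge (k + 1) N with h | h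
  · rw [← Nat.cast_succ, mem_vertexInterval_natCast h]
    omega
  · have hN : k + 1 = N := by omega
    have h0 : (k : ZMod N) + 1 = 0 := by
      rw [← Nat.cast_succ, Nat.succ_eq_add_one, hN, ZMod.natCast_self]
    rw [h0, vertexInterval, mem_ofPred_eq, ZMod.val_zero]
    omega

lemma mem_iff_of_sym2_eq {V : Type*} {U : Set V} {u v x y : V} (h : s(u, v) = s(x, y))
    (huv : u ∈ U ↔ v ∈ U) : x ∈ U → y ∈ U := by
  rw [Sym2.eq_iff] at h
  rcases h with ⟨rfl, rfl⟩ | ⟨rfl, rfl⟩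
  · exact huv.1
  · exact huv.2

lemma exists_link_of_sym2 {V β : Type*} {G : Graph V β} {f : β} {U : Set V} {u v : V}
    (h : G.IsLink f u v) (huv : ¬ (u ∈ U ↔ v ∈ U)) :
    ∃ x y, G.IsLink f x y ∧ x ∈ U ∧ y ∉ U := by
  by_cases hu : u ∈ U
  · exact ⟨u, v, h, hu, fun hv ↦ huv ⟨fun _ ↦ hv, fun _ ↦ hu⟩⟩
  · exact ⟨v, u, h.symm, by_contra fun hv ↦ huv ⟨fun h ↦ (hu h).elim, fun h ↦ (hv h).elim⟩, hu⟩

/-- Removing the edges `k` and `m` cuts the long cycle into two arcs, and the arc avoiding `0` is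
the cut. The chord `none` crosses it exactly if `k` and `m` lie on different sides of the chord. -/
lemma exists_cut_some (ha : 2 ≤ a) (hb : 2 ≤ b) {I : Set (Option (Fin (a + b - 2)))}
    {k m : Fin (a + b - 2)} (hkm : k ≠ m) (hm : some m ∉ I)
    (h : none ∉ I ∨ ((k : ℕ) < a - 1 ↔ (m : ℕ) < a - 1)) :
    ∃ U : Set (ZMod (a + b - 2)),
      (∃ x y, (gluedCyclesGraph a b).IsLink (some k) x y ∧ x ∈ U ∧ y ∉ U) ∧
      ∀ g ∈ I, g ≠ some k → ∀ x y, (gluedCyclesGraph a b).IsLink g x y → x ∈ U → y ∈ U := by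
  have hkm' : (k : ℕ) ≠ m := fun h ↦ hkm (Fin.ext h)
  have hk := k.2
  have hm' := m.2
  refine ⟨vertexInterval _ (min (k : ℕ) m) (max (k : ℕ) m), ?_, ?_⟩
  · refine exists_link_of_sym2 (gluedCyclesGraph_isLink_some.2 rfl) ?_
    rw [mem_vertexInterval_natCast k.2, mem_vertexInterval_natCast_add_one k.2 (by omega)]
    omega
  · intro g hg hgk x y hl
    cases g with
    | none =>
      refine mem_iff_of_sym2_eq (gluedCyclesGraph_isLink_none.1 hl) ?_
      have h0 : ((0 : ℕ) : ZMod (a + b - 2)) = 0 := Nat.cast_zero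
      rw [← h0, mem_vertexInterval_natCast (by omega), mem_vertexInterval_natCast (by omega)]
      have := h.resolve_left (fun h ↦ h hg)
      omega
    | some l =>
      have h1 : (l : ℕ) ≠ k := fun h ↦ hgk (congrArg some (Fin.ext h))
      have h2 : (l : ℕ) ≠ m := fun h ↦ hm ((Fin.ext h : l = m) ▸ hg)
      refine mem_iff_of_sym2_eq (gluedCyclesGraph_isLink_some.1 hl) ?_
      rw [mem_vertexInterval_natCast l.2, mem_vertexInterval_natCast_add_one l.2 (by omega)]
      omega

lemma exists_cut_none {I : Set (Option (Fin (a + b - 2)))}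
    {k m : Fin (a + b - 2)} (hkI : some k ∉ I) (hmI : some m ∉ I) (hk : (k : ℕ) < a - 1)
    (hm : a - 1 ≤ (m : ℕ)) :
    ∃ U : Set (ZMod (a + b - 2)),
      (∃ x y, (gluedCyclesGraph a b).IsLink none x y ∧ x ∈ U ∧ y ∉ U) ∧
      ∀ g ∈ I, g ≠ none → ∀ x y, (gluedCyclesGraph a b).IsLink g x y → x ∈ U → y ∈ U := by
  have hm' := m.2
  refine ⟨vertexInterval _ k m, ?_, ?_⟩
  · refine exists_link_of_sym2 (gluedCyclesGraph_isLink_none.2 rfl) ?_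
    have h0 : ((0 : ℕ) : ZMod (a + b - 2)) = 0 := Nat.cast_zero
    rw [← h0, mem_vertexInterval_natCast (by omega), mem_vertexInterval_natCast (by omega)]
    omega
  · intro g hg hgk x y hl
    cases g with
    | none => exact (hgk rfl).elim
    | some l =>
      have h1 : (l : ℕ) ≠ k := fun h ↦ hkI ((Fin.ext h : l = k) ▸ hg)
      have h2 : (l : ℕ) ≠ m := fun h ↦ hmI ((Fin.ext h : l = m) ▸ hg)
      refine mem_iff_of_sym2_eq (gluedCyclesGraph_isLink_some.1 hl) ?_
      rw [mem_vertexInterval_natCast l.2, mem_vertexInterval_natCast_add_one l.2 (by omega)]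
      omega

lemma isForest_of_notMem (ha : 2 ≤ a) (hb : 2 ≤ b) {I : Set (Option (Fin (a + b - 2)))}
    {k m : Fin (a + b - 2)} (hkI : some k ∉ I) (hmI : some m ∉ I) (hk : (k : ℕ) < a - 1)
    (hm : a - 1 ≤ (m : ℕ)) : (gluedCyclesGraph a b).IsForest I := by
  refine Graph.isForest_of_forall_exists_cut (toFinite I) fun f hf ↦ ?_
  cases f with
  | none => exact exists_cut_none hkI hmI hk hm
  | some j =>
    by_cases hj : (j : ℕ) < a - 1
    · exact exists_cut_some ha hb (m := k) (by rintro rfl; exact hkI hf) hkI (Or.inr (by omega))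
    · exact exists_cut_some ha hb (m := m) (by rintro rfl; exact hmI hf) hmI (Or.inr (by omega))

lemma isForest_of_none_notMem (ha : 2 ≤ a) (hb : 2 ≤ b) {I : Set (Option (Fin (a + b - 2)))}
    {k : Fin (a + b - 2)} (hkI : some k ∉ I) (hI : none ∉ I) :
    (gluedCyclesGraph a b).IsForest I := by
  refine Graph.isForest_of_forall_exists_cut (toFinite I) fun f hf ↦ ?_
  cases f with
  | none => exact (hI hf).elim
  | some j => exact exists_cut_some ha hb (m := k) (by rintro rfl; exact hkI hf) hkI (Or.inl hI)

lemma reachable_of_forall_mem {I : Set (Option (Fin (a + b - 2)))} {i j : ℕ} (hij : i ≤ j)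
    (hj : j ≤ a + b - 2)
    (h : ∀ k : Fin (a + b - 2), i ≤ (k : ℕ) → (k : ℕ) < j → some k ∈ I) :
    ((gluedCyclesGraph a b).simpleGraphOn I).Reachable (i : ZMod (a + b - 2)) j := by
  induction j, hij using Nat.le_induction with
  | base => exact SimpleGraph.Reachable.refl _
  | succ j hij ih =>
    refine (ih (by omega) fun k h1 h2 ↦ h k h1 (by omega)).trans ?_
    -- Consecutive vertices can coincide only modulo `1`; adjacency requires them to be distinct.
    by_cases heq : (j : ZMod (a + b - 2)) = ((j + 1 : ℕ) : ZMod (a + b - 2))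
    · rw [← heq]
    · refine SimpleGraph.Adj.reachable ⟨heq, some ⟨j, by omega⟩, h _ hij (by simp), ?_⟩
      rw [gluedCyclesGraph_isLink_some, Nat.cast_succ]

lemma not_isForest_of_left {I : Set (Option (Fin (a + b - 2)))} (ha : 2 ≤ a) (hb : 2 ≤ b)
    (h0 : none ∈ I) (h : ∀ k : Fin (a + b - 2), (k : ℕ) < a - 1 → some k ∈ I) :
    ¬ (gluedCyclesGraph a b).IsForest I := by
  intro hI
  have hI' := hI.subset (sdiff_subset (t := {none}))
  have hl := gluedCyclesGraph_isLink_none (a := a) (b := b).2 rfl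
  refine (Graph.isForest_insert_iff hI' (by simp) hl).1 ?_ ?_
  · rwa [insert_sdiff_singleton, insert_eq_of_mem h0]
  · have := reachable_of_forall_mem (I := I \ {none}) (Nat.zero_le (a - 1)) (by omega)
      (fun k _ hk ↦ ⟨h k hk, by simp⟩)
    rwa [Nat.cast_zero] at this

lemma not_isForest_of_right {I : Set (Option (Fin (a + b - 2)))} (ha : 2 ≤ a) (hb : 2 ≤ b)
    (h0 : none ∈ I) (h : ∀ k : Fin (a + b - 2), a - 1 ≤ (k : ℕ) → some k ∈ I) :
    ¬ (gluedCyclesGraph a b).IsForest I := by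
  intro hI
  have hI' := hI.subset (sdiff_subset (t := {none}))
  have hl := gluedCyclesGraph_isLink_none (a := a) (b := b).2 rfl
  refine (Graph.isForest_insert_iff hI' (by simp) hl).1 ?_ ?_
  · rwa [insert_sdiff_singleton, insert_eq_of_mem h0]
  · have := reachable_of_forall_mem (I := I \ {none}) (i := a - 1) (j := a + b - 2) (by omega)
      le_rfl (fun k hk _ ↦ ⟨h k hk, by simp⟩)
    rw [ZMod.natCast_self] at this
    exact this.symm

lemma not_isForest_of_forall {I : Set (Option (Fin (a + b - 2)))} (ha : 2 ≤ a) (hb : 2 ≤ b)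
    (h : ∀ k : Fin (a + b - 2), some k ∈ I) :
    ¬ (gluedCyclesGraph a b).IsForest I := by
  intro hI
  -- The last edge returns to `0`; without it the other edges still form a path from `0` to its
  -- other end.
  let m : Fin (a + b - 2) := ⟨a + b - 2 - 1, by omega⟩
  have hI' := hI.subset (sdiff_subset (t := {some m}))
  have hl := gluedCyclesGraph_isLink_some (a := a) (b := b) (j := m).2 rfl
  refine (Graph.isForest_insert_iff hI' (by simp) hl).1 ?_ ?_
  · rwa [insert_sdiff_singleton, insert_eq_of_mem (h m)]
  · have := reachable_of_forall_mem (I := I \ {some m}) (Nat.zero_le (m : ℕ)) m.2.le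
      (fun k _ hk ↦ ⟨h k, by
        rw [mem_singleton_iff, Option.some_inj]
        rintro rfl
        exact hk.ne rfl⟩)
    have hm : ((m : ℕ) : ZMod (a + b - 2)) + 1 = 0 := by
      rw [← Nat.cast_succ, Nat.succ_eq_add_one, show (m : ℕ) + 1 = a + b - 2 by
        simp only [m]; omega, ZMod.natCast_self]
    rw [hm]
    rw [Nat.cast_zero] at this
    exact this.symm

/-- The edges of the first cycle of the glued cycles, without the common edge. -/
def leftEdges (a b : ℕ) : Finset (Option (Fin (a + b - 2))) :=
  (Finset.univ.filter fun k : Fin (a + b - 2) ↦ (k : ℕ) < a - 1).map Function.Embedding.some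

/-- The edges of the second cycle of the glued cycles, without the common edge. -/
def rightEdges (a b : ℕ) : Finset (Option (Fin (a + b - 2))) :=
  (Finset.univ.filter fun k : Fin (a + b - 2) ↦ ¬ (k : ℕ) < a - 1).map Function.Embedding.some

lemma some_mem_leftEdges {k : Fin (a + b - 2)} : some k ∈ leftEdges a b ↔ (k : ℕ) < a - 1 := by
  simp [leftEdges]

lemma none_notMem_leftEdges : none ∉ leftEdges a b := by
  simp [leftEdges]

lemma some_mem_rightEdges {k : Fin (a + b - 2)} :
    some k ∈ rightEdges a b ↔ ¬ (k : ℕ) < a - 1 := by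
  simp [rightEdges]

lemma none_notMem_rightEdges : none ∉ rightEdges a b := by
  simp [rightEdges]

lemma card_leftEdges (hb : 2 ≤ b) : (leftEdges a b).card = a - 1 := by
  rw [leftEdges, Finset.card_map, Fin.card_filter_val_lt]
  omega

lemma card_rightEdges (ha : 2 ≤ a) (hb : 2 ≤ b) : (rightEdges a b).card = b - 1 := by
  have h1 := card_leftEdges (a := a) hb
  have h2 := Finset.card_filter_add_card_filter_not (s := (Finset.univ : Finset (Fin (a + b - 2))))
    (fun k : Fin (a + b - 2) ↦ (k : ℕ) < a - 1)
  rw [leftEdges, Finset.card_map] at h1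
  rw [Finset.card_univ, Fintype.card_fin] at h2
  rw [rightEdges, Finset.card_map]
  omega

/-- A set containing none of the three cycles either contains `none` and misses an edge on each
side, or avoids `none` and misses some edge of the long cycle; in both cases cuts show that it is a
forest. -/
lemma isTheta_gluedCycles (ha : 2 ≤ a) (hb : 2 ≤ b) :
    IsTheta (gluedCycles a b) (leftEdges a b) (rightEdges a b) none where
  ground := by
    rw [gluedCycles_ground, eq_comm, eq_univ_iff_forall]
    rintro (_ | k)
    · simp
    · have := em ((k : ℕ) < a - 1)
      simpa [some_mem_leftEdges, some_mem_rightEdges] using this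
  disjoint := by
    rw [Finset.disjoint_left]
    rintro (_ | k) h1 h2
    · exact none_notMem_leftEdges h1
    · exact some_mem_rightEdges.1 h2 (some_mem_leftEdges.1 h1)
  notMem_left := none_notMem_leftEdges
  notMem_right := none_notMem_rightEdges
  nonempty_left := by
    rw [← Finset.card_pos, card_leftEdges hb]
    omega
  nonempty_right := by
    rw [← Finset.card_pos, card_rightEdges ha hb]
    omega
  indep_iff I := by
    rw [gluedCycles_indep_iff]
    constructor
    · intro hI
      refine ⟨?_, fun h ↦ ?_, fun h ↦ ?_, fun h ↦ ?_⟩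
      · rintro (_ | k) -
        · simp
        · have := em ((k : ℕ) < a - 1)
          simpa [some_mem_leftEdges, some_mem_rightEdges] using this
      · rw [Finset.insert_subset_iff] at h
        exact not_isForest_of_left ha hb h.1 (fun k hk ↦ h.2 (some_mem_leftEdges.2 hk)) hI
      · rw [Finset.insert_subset_iff] at h
        exact not_isForest_of_right ha hb h.1
          (fun k hk ↦ h.2 (some_mem_rightEdges.2 (by omega))) hI
      · refine not_isForest_of_forall ha hb (fun k ↦ h ?_) hI
        rw [Finset.mem_union, some_mem_leftEdges, some_mem_rightEdges]
        exact em _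
    · rintro ⟨-, h1, h2, h3⟩
      by_cases h0 : none ∈ I
      · rw [Finset.insert_subset_iff, not_and] at h1 h2
        obtain ⟨x, hx, hxI⟩ := Finset.not_subset.1 (h1 h0)
        obtain ⟨y, hy, hyI⟩ := Finset.not_subset.1 (h2 h0)
        cases x with
        | none => exact (none_notMem_leftEdges hx).elim
        | some k =>
          cases y with
          | none => exact (none_notMem_rightEdges hy).elim
          | some m =>
            exact isForest_of_notMem ha hb hxI hyI (some_mem_leftEdges.1 hx)
              (not_lt.1 (some_mem_rightEdges.1 hy))
      · obtain ⟨x, hx, hxI⟩ := Finset.not_subset.1 h3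
        cases x with
        | none => simp [none_notMem_leftEdges, none_notMem_rightEdges] at hx
        | some k => exact isForest_of_none_notMem ha hb hxI h0

end GluedCycles

theorem proposition4p3 (a b n : ℕ) (ha : 2 ≤ a) (hb : 2 ≤ b) (hn : n = a + b - 1) :
    inverseKLPoly (gluedCycles a b) =
        inverseKLPoly (uniformMatroid (n - 2) (n - 1)) +
          (1 + X) * inverseKLPoly (uniformMatroid (a - 2) (a - 1)) *
            inverseKLPoly (uniformMatroid (b - 2) (b - 1)) -
          (C (klTau (uniformMatroid (a - 2) (a - 1))) * X ^ ((a - 1) / 2) *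
              inverseKLPoly (uniformMatroid (b - 2) (b - 1)) +
            C (klTau (uniformMatroid (b - 2) (b - 1))) * X ^ ((b - 1) / 2) *
              inverseKLPoly (uniformMatroid (a - 2) (a - 1))) ∧
      inverseZPoly (gluedCycles a b) =
        inverseZPoly (uniformMatroid (n - 2) (n - 1)) +
          (1 + X) * inverseZPoly (uniformMatroid (a - 2) (a - 1)) *
            inverseZPoly (uniformMatroid (b - 2) (b - 1)) -
          (C (klTau (uniformMatroid (a - 2) (a - 1))) * X ^ ((a - 1) / 2) *
              inverseZPoly (uniformMatroid (b - 2) (b - 1)) +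
            C (klTau (uniformMatroid (b - 2) (b - 1))) * X ^ ((b - 1) / 2) *
              inverseZPoly (uniformMatroid (a - 2) (a - 1))) := by
  subst hn
  have h := isTheta_gluedCycles ha hb
  -- The parameters are `p = a - 1` and `r = b - 1`, so the large circuit has `p + r = n - 1`
  -- elements.
  have hs : a - 1 + (b - 1) = a + b - 1 - 1 := by omega
  rw [h.inverseKLPoly_eq, h.inverseZPoly_eq, card_leftEdges hb, card_rightEdges ha hb, thetaQ,
    thetaY, hs]
  rw [inverseKLPoly_uniformMatroid (k := a + b - 1 - 1) (by omega) (by omega),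
    inverseKLPoly_uniformMatroid (k := a - 1) (by omega) (by omega),
    inverseKLPoly_uniformMatroid (k := b - 1) (by omega) (by omega),
    inverseZPoly_uniformMatroid (k := a + b - 1 - 1) (by omega) (by omega),
    inverseZPoly_uniformMatroid (k := a - 1) (by omega) (by omega),
    inverseZPoly_uniformMatroid (k := b - 1) (by omega) (by omega),
    klTau_uniformMatroid (k := a - 1) (by omega) (by omega),
    klTau_uniformMatroid (k := b - 1) (by omega) (by omega)]
  exact ⟨rfl, rfl⟩
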